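/- Consider $S$ base stations (BSs) $s$, $N$ service types $n$, and positive constants $d_n,h_{sn},w_{sn},\sigma_{sn}$, rates $\lambda_{sn}\ge 0$, a confidence level $\theta\in(0,1)$, a reserved bandwidth $b_0\ge 0$, and real numbers $\beta_s,\overline{T_n},\gamma$. Let $\theta_{sn}$ be the $\theta$-quantile of the Poisson distribution with mean $\lambda_{sn}$ (the least integer $m\ge 0$ with $\Pr(k_{sn}\le m)\ge\theta$). For bandwidths $b_{sn}$ and processing powers $\mu_{sn}$ let $$t_{sn}=\frac{d_n}{b_{sn}\log(1+h_{sn}w_{sn}/\sigma_{sn})}+\frac1{\mu_{sn}-\lambda_{sn}} .$$ The joint network slicing problem is $$\min_{b,\mu}\ \sum_{s}\sum_{n}t_{sn}\quad\text{s.t.}\quad b_{sn}>b_0,\ \ \mu_{sn}>\lambda_{sn},\ \ t_{sn}\le\overline{T_n},\ \ \sum_{n}\theta_{sn}b_{sn}\le\beta_s,\ \ \sum_{s}\sum_{n}\mu_{sn}\le\gamma\qquad(\forall s,n).$$ Write $x_s=(b_{sn},\mu_{sn})_n\in\mathbb R^{2N}$, $x=(x_s)_s$, $f(x_s)=\sum_n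 t_{sn}$, $F(x)=\sum_s f(x_s)$; let $\mathcal G_s$ be the set of all $x_s$ that satisfy the first four constraints for the given $s$ and all $n$, and let $\mathcal G$ be the half-space of all $z\in\mathbb R^{2NS}$ whose processing-power components have sum at most $\gamma$. For a penalty $\rho>0$ and arbitrary starting values $z^0,\Lambda^0\in\mathbb R^{2NS}$, a run of the DistADMM-PVS algorithm is a sequence $(x^k,z^k,\Lambda^k)$ such that for all $k\ge 0$ $$x_s^{k+1}\in\operatorname*{argmin}_{x_s\in\mathcal G_s}\Big\{f(x_s)+\tfrac{\rho}{2}\|x_s-z_s^k+\Lambda_s^k\|_2^2\Big\}\ \ (\forall s),\qquad z^{k+1}=\Pi_{\mathcal G}(x^{k+1}+\Lambda^k),\qquad \Lambda^{k+1}=\Lambda^k+x^{k+1}-z^{k+1},$$ where $\Pi_{\mathcal G}$ is the Euclidean projection onto $\mathcal G$. Theorem. Let $x^\star$ be a global optimal solution of the joint network slicing problem. Then every run of DistADMM-PVS converges to $x^\star$ at rate $O(1/t)$: $x^t\to x^\star$, $z^t\to x^\star$, $F(x^t)\to F(x^\star)$, and there is a constant $C$ (which may depend on the problem data, on $\rho$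 and on the run, but not on $t$) such that for all $t\ge 1$ $$\|x^t-x^\star\|_2\le\frac Ct,\qquad \|z^t-x^\star\|_2\le\frac Ct,\qquad |F(x^t)-F(x^\star)|\le\frac Ct .$$ -/

import Mathlib

open Filter Topology
open scoped NNReal

noncomputable section

namespace NetSlicing

/-- A local vector `x_s = ⟨b_s, μ_s⟩` of one base station (BS), with the Euclidean norm.
`Sum.inl n` indexes the bandwidth `b_{sn}`, `Sum.inr n` the processing power `μ_{sn}`. -/
abbrev LocalVec (N : ℕ) : Type := EuclideanSpace ℝ (Fin N ⊕ Fin N)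

/-- A global vector `x = (x_s)_s` with the Euclidean norm. -/
abbrev GlobalVec (S N : ℕ) : Type := PiLp 2 (fun _ : Fin S => LocalVec N)

/-- The bandwidth component `b_{sn}` of a local vector. -/
def bw {N : ℕ} (v : LocalVec N) (n : Fin N) : ℝ := v (Sum.inl n)

/-- The processing-power component `μ_{sn}` of a local vector. -/
def pw {N : ℕ} (v : LocalVec N) (n : Fin N) : ℝ := v (Sum.inr n)

/-- The generalized inverse of the cumulative distribution function of the Poisson law with
mean `r`: the least `m` such that `P(k ≤ m) ≥ p`. -/
def poissonQuantile (p : ℝ) (r : ℝ≥0) : ℕ :=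
  sInf {m : ℕ | p ≤ (ProbabilityTheory.poissonMeasure r).real (Set.Iic m)}

/-- The data of the slicing problem with `S` base stations and `N` service types. -/
structure Network (S N : ℕ) where
  /-- data size of a task unit of each service type -/
  d : Fin N → ℝ
  /-- channel gain -/
  h : Fin S → Fin N → ℝ
  /-- transmission power -/
  w : Fin S → Fin N → ℝ
  /-- noise level -/
  σ : Fin S → Fin N → ℝ
  /-- expected number of arriving task units (mean of the Poisson arrivals) -/
  rate : Fin S → Fin N → ℝ≥0
  /-- confidence level `θ` -/
  conf : ℝ
  /-- reserved bandwidth `b_0` -/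
  b₀ : ℝ
  /-- total bandwidth of each BS -/
  β : Fin S → ℝ
  /-- maximum tolerable latency of each service type -/
  Tmax : Fin N → ℝ
  /-- total computational resource -/
  γ : ℝ
  d_pos : ∀ n, 0 < d n
  h_pos : ∀ s n, 0 < h s n
  w_pos : ∀ s n, 0 < w s n
  σ_pos : ∀ s n, 0 < σ s n
  conf_pos : 0 < conf
  conf_lt_one : conf < 1
  b₀_nonneg : 0 ≤ b₀

variable {S N : ℕ}

/-- The threshold `θ_{sn}`: the quantile of order `θ` of the Poisson arrivals. -/
def Network.threshold (P : Network S N) (s : Fin S) (n : Fin N) : ℝ :=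
  (poissonQuantile P.conf (P.rate s n) : ℝ)

/-- Communication delay `p_{sn}`. -/
def Network.commDelay (P : Network S N) (s : Fin S) (n : Fin N) (b : ℝ) : ℝ :=
  P.d n / (b * Real.log (1 + P.h s n * (P.w s n / P.σ s n)))

/-- Queuing delay `q_{sn}` (M/M/1). -/
def Network.queueDelay (P : Network S N) (s : Fin S) (n : Fin N) (μ : ℝ) : ℝ :=
  1 / (μ - (P.rate s n : ℝ))

/-- Service response time `t_{sn} = p_{sn} + q_{sn}`. -/
def Network.respTime (P : Network S N) (s : Fin S) (v : LocalVec N) (n : Fin N) : ℝ :=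
  P.commDelay s n (bw v n) + P.queueDelay s n (pw v n)

/-- The local objective `f(x_s) = ∑_n t_{sn}`. -/
def Network.localLatency (P : Network S N) (s : Fin S) (v : LocalVec N) : ℝ :=
  ∑ n, P.respTime s v n

/-- The objective of the joint slicing problem, `∑_s ∑_n t_{sn}`. -/
def Network.totalLatency (P : Network S N) (x : GlobalVec S N) : ℝ :=
  ∑ s, ∑ n, P.respTime s (x s) n

/-- All the constraints of the joint slicing problem. -/
structure Network.IsFeasible (P : Network S N) (x : GlobalVec S N) : Prop where
  bandwidth_reserved : ∀ s n, P.b₀ < bw (x s) n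
  power_reserved : ∀ s n, (P.rate s n : ℝ) < pw (x s) n
  latency : ∀ s n, P.respTime s (x s) n ≤ P.Tmax n
  bandwidth : ∀ s, ∑ n, P.threshold s n * bw (x s) n ≤ P.β s
  power : ∑ s, ∑ n, pw (x s) n ≤ P.γ

/-- `x` is a global optimal solution of the joint slicing problem. -/
def Network.IsGlobalOptimum (P : Network S N) (x : GlobalVec S N) : Prop :=
  P.IsFeasible x ∧ ∀ y, P.IsFeasible y → P.totalLatency x ≤ P.totalLatency y

/-- The local feasible set `G_s` of BS `s`. -/
def Network.localSet (P : Network S N) (s : Fin S) : Set (LocalVec N) :=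
  {v | (∀ n, P.b₀ < bw v n) ∧ (∀ n, (P.rate s n : ℝ) < pw v n) ∧
    (∀ n, P.respTime s v n ≤ P.Tmax n) ∧ ∑ n, P.threshold s n * bw v n ≤ P.β s}

/-- The half-space `G` of the regional orchestrator (RO). -/
def Network.halfSpace (P : Network S N) : Set (GlobalVec S N) :=
  {z | ∑ s, ∑ n, pw (z s) n ≤ P.γ}

/-- The objective of the proximal sub-problem of BS `s`, given the blocks `z_s` and `Λ_s`. -/
def Network.proxObjective (P : Network S N) (ρ : ℝ) (s : Fin S) (zs Ls v : LocalVec N) : ℝ :=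
  P.localLatency s v + ρ / 2 * ‖v - zs + Ls‖ ^ 2

/-- `(x, z, L)` is a run of DistADMM-PVS with penalty `ρ`; the starting values `z 0` and `L 0`
are arbitrary (`L` is the scaled dual variable `Λ`). -/
structure Network.IsRun (P : Network S N) (ρ : ℝ) (x z L : ℕ → GlobalVec S N) : Prop where
  /-- Each BS minimizes its proximal sub-problem over its own set
  (equivalently, minimizes the objective plus the indicator function of that set). -/
  x_mem : ∀ k s, x (k + 1) s ∈ P.localSet s
  x_min : ∀ k s, IsMinOn (P.proxObjective ρ s (z k s) (L k s)) (P.localSet s) (x (k + 1) s)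
  /-- The RO projects `x^{k+1} + Λ^k` onto the half-space. -/
  z_mem : ∀ k, z (k + 1) ∈ P.halfSpace
  z_min : ∀ k, IsMinOn (fun y => dist (x (k + 1) + L k) y) P.halfSpace (z (k + 1))
  /-- The RO updates the dual variable. -/
  dual_update : ∀ k, L (k + 1) = L k + x (k + 1) - z (k + 1)

end NetSlicing

end

/-!
Every run converges linearly, which is more than the rate `1 / t`. The half-space has a single
normal direction `a` (`powerNormal`), so after one step the scaled dual variable is `τ k • a` with
`τ k ≥ 0` (`exists_normal_of_isMinOn_dist`), and a Lagrange multiplier is a single number.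

*Multipliers.* The optimum exhausts the computational resource. No constraint qualification is
available, as the feasible set may be a single point; but multipliers can be written down. If the
latency of some service is slack at the optimum, its marginal queuing delay is the multiplier
(`multiplier_of_slack`). If all latencies are tight, the optimum has the largest total latency that
the constraints allow, and every number above all marginal queuing delays is a multiplier
(`multiplier_of_tight`).

*Convergence.* The squared distance of `(z, τ • a)` to a primal-dual solution decreases by the
squared step lengths and a multiple of the squared primal error (`lyapunov_step`), because the
delays are strongly convex on bounded sets. Hence runs are bounded and `x k` converges.

*Rate.* The stationarity of the proximal step with respect to a single processing power compares
`τ k` with a marginal queuing delay, which is locally Lipschitz. So, near the optimum, the distance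
of `τ k` to the set of multipliers is controlled by the primal error and the last step
(`exists_dual_error_bound`). Together with strong convexity this bounds the distance to the
solution set by the step lengths, and then by the decrease of the Lyapunov function, which
makes the decay geometric (`linear_rate`). The objective error is at most proportional to the
primal error (`objective_error`), by the variational inequality of the proximal step and the
saddle point property.
-/

namespace NetSlicing

/-! ### Splitting over a convex set and a half-space in a Hilbert space -/

section Abstract

open scoped RealInnerProductSpace

/-- The squared distance of `(z, τ • a)` to the primal-dual solution `(xs, σ • a)`. -/
def lyapunov {E : Type*} [NormedAddCommGroup E] (a xs : E) (σ : ℝ) (z : E) (τ : ℝ) : ℝ :=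
  ‖z - xs‖ ^ 2 + ‖a‖ ^ 2 * (τ - σ) ^ 2

theorem lyapunov_nonneg {E : Type*} [NormedAddCommGroup E] (a xs : E) (σ : ℝ) (z : E)
    (τ : ℝ) : 0 ≤ lyapunov a xs σ z τ := by
  unfold lyapunov; positivity

variable {E : Type*} [NormedAddCommGroup E] [InnerProductSpace ℝ E]

theorem le_of_forall_small_mul_le {A B : ℝ} (h : ∀ ε : ℝ, 0 < ε → ε ≤ 1 → 0 ≤ A + ε * B) :
    0 ≤ A := by
  have h1 : Tendsto (fun ε : ℝ => A + ε * B) (𝓝[>] 0) (𝓝 (A + 0 * B)) :=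
    ((continuous_const.add (continuous_id.mul continuous_const)).tendsto 0).mono_left
      nhdsWithin_le_nhds
  have h2 : ∀ᶠ ε : ℝ in 𝓝[>] 0, 0 ≤ A + ε * B := by
    filter_upwards [Ioc_mem_nhdsGT (zero_lt_one' ℝ)] with ε hε using h ε hε.1 hε.2
  simpa using ge_of_tendsto h1 h2

/-- First-order optimality of a proximal step, in the form of a subgradient inequality:
no differentiability of `F` is needed. -/
theorem prox_variational {K : Set E} {F : E → ℝ} (hF : ConvexOn ℝ K F) {ρ : ℝ}
    {c x : E} (hx : x ∈ K) (hmin : IsMinOn (fun v => F v + ρ / 2 * ‖v - c‖ ^ 2) K x)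
    {y : E} (hy : y ∈ K) : F x ≤ F y + ρ * ⟪x - c, y - x⟫ := by
  suffices h : 0 ≤ (F y + ρ * ⟪x - c, y - x⟫ - F x) by linarith
  refine le_of_forall_small_mul_le (B := ρ / 2 * ‖y - x‖ ^ 2) fun ε h0 h1 => ?_
  have hc : (1 - ε) • x + ε • y ∈ K := hF.1 hx hy (by linarith) h0.le (by ring)
  have h2 := hmin hc
  have h3 := hF.2 hx hy (by linarith : 0 ≤ 1 - ε) h0.le (by ring)
  simp only [Set.mem_ofPred_eq, smul_eq_mul] at h2 h3
  have h4 : (1 - ε) • x + ε • y - c = (x - c) + ε • (y - x) := by module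
  rw [h4, norm_add_sq_real, inner_smul_right, norm_smul, Real.norm_eq_abs, mul_pow, sq_abs] at h2
  have h5 : 0 ≤ ε * (F y + ρ * ⟪x - c, y - x⟫ - F x + ε * (ρ / 2 * ‖y - x‖ ^ 2)) := by
    linarith
  exact nonneg_of_mul_nonneg_right h5 h0

/-- The residual of the projection onto a half-space with normal `a` is a nonnegative multiple
of `a`, and vanishes unless the constraint is active. -/
theorem exists_normal_of_isMinOn_dist {a : E} (ha : a ≠ 0) {γ : ℝ} {u z : E}
    (hz : ⟪a, z⟫ ≤ γ) (hmin : IsMinOn (fun y => dist u y) {y | ⟪a, y⟫ ≤ γ} z) :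
    ∃ τ : ℝ, 0 ≤ τ ∧ u - z = τ • a ∧ τ * (⟪a, z⟫ - γ) = 0 := by
  have haa : 0 < ⟪a, a⟫ := real_inner_self_pos.2 ha
  have hvi : ∀ v : E, ⟪a, z + v⟫ ≤ γ → ⟪u - z, v⟫ ≤ 0 := by
    intro v hv
    suffices h : 0 ≤ -(2 * ⟪u - z, v⟫) by linarith
    refine le_of_forall_small_mul_le (B := ‖v‖ ^ 2) fun ε h0 h1 => ?_
    have hmem : ⟪a, z + ε • v⟫ ≤ γ := by
      rw [inner_add_right] at hv ⊢
      rw [inner_smul_right]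
      nlinarith
    have h2 := hmin hmem
    simp only [Set.mem_ofPred_eq, dist_eq_norm] at h2
    have h3 : u - (z + ε • v) = (u - z) - ε • v := by module
    rw [h3] at h2
    have h4 := pow_le_pow_left₀ (norm_nonneg _) h2 2
    rw [norm_sub_sq_real (u - z), inner_smul_right, norm_smul, Real.norm_eq_abs, mul_pow,
      sq_abs] at h4
    have h5 : 0 ≤ ε * (-(2 * ⟪u - z, v⟫) + ε * ‖v‖ ^ 2) := by linarith
    exact nonneg_of_mul_nonneg_right h5 h0
  set τ : ℝ := ⟪u - z, a⟫ / ⟪a, a⟫ with hτ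
  have hτa : τ * ⟪a, a⟫ = ⟪u - z, a⟫ := div_mul_cancel₀ _ haa.ne'
  have hperp : ⟪a, u - z - τ • a⟫ = 0 := by
    rw [inner_sub_right, inner_smul_right, hτa, real_inner_comm, sub_self]
  have h1 : ⟪u - z, u - z - τ • a⟫ ≤ 0 := hvi _ (by rw [inner_add_right, hperp]; linarith)
  have h2 : ⟪u - z - τ • a, u - z - τ • a⟫ ≤ 0 := by
    rw [inner_sub_left, inner_smul_left, hperp]
    simpa using h1
  have h3 : u - z - τ • a = 0 :=
    inner_self_eq_zero.1 (le_antisymm h2 real_inner_self_nonneg)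
  have h4 : 0 ≤ τ := by
    have := hvi (-a) (by rw [inner_add_right, inner_neg_right]; linarith)
    rw [inner_neg_right, ← hτa] at this
    exact nonneg_of_mul_nonneg_left (by linarith) haa
  refine ⟨τ, h4, sub_eq_zero.1 h3, ?_⟩
  have h5 : ⟪u - z, ((γ - ⟪a, z⟫) / ⟪a, a⟫) • a⟫ ≤ 0 := hvi _ (by
    rw [inner_add_right, inner_smul_right, div_mul_cancel₀ _ haa.ne']; linarith)
  rw [inner_smul_right, ← hτa] at h5
  have h6 : τ * (γ - ⟪a, z⟫) ≤ 0 := by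
    calc τ * (γ - ⟪a, z⟫) = (γ - ⟪a, z⟫) / ⟪a, a⟫ * (τ * ⟪a, a⟫) := by
          field_simp
      _ ≤ 0 := h5
  nlinarith [mul_nonneg h4 (sub_nonneg.2 hz)]

/-- The relations satisfied by an ADMM run that alternates between the minimization of `F` over
`K` and the projection onto the half-space `{z | ⟪a, z - xs⟫ ≤ 0}`. The scaled dual variable
lies on the normal ray of the half-space and is recorded by its coordinate `τ k`. The proximal
step appears through its variational inequality only. -/
structure HalfSpaceSplitting (K : Set E) (F : E → ℝ) (a : E) (ρ : ℝ) (xs : E)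
    (x z : ℕ → E) (τ : ℕ → ℝ) : Prop where
  mem : ∀ k, x (k + 1) ∈ K
  prox : ∀ k, ∀ y ∈ K,
    F (x (k + 1)) ≤ F y + ρ * ⟪x (k + 1) - z k + τ k • a, y - x (k + 1)⟫
  half : ∀ k, ⟪a, z k - xs⟫ ≤ 0
  dual_nonneg : ∀ k, 0 ≤ τ k
  slack : ∀ k, τ k * ⟪a, z k - xs⟫ = 0
  dual : ∀ k, x (k + 1) - z (k + 1) = (τ (k + 1) - τ k) • a

/-- `σ` is a Lagrange multiplier, in units of the penalty `ρ`, of the half-space constraint at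
the solution `xs`: the Lagrangian attains its minimum over `K` at `xs`. -/
def IsScaledMultiplier (K : Set E) (F : E → ℝ) (a : E) (ρ : ℝ) (xs : E) (σ : ℝ) : Prop :=
  0 ≤ σ ∧ ∀ y ∈ K, F xs ≤ F y + ρ * σ * ⟪a, y - xs⟫

variable {K : Set E} {F : E → ℝ} {a : E} {ρ : ℝ} {xs : E} {x z : ℕ → E} {τ : ℕ → ℝ}

namespace HalfSpaceSplitting

/-- The variational inequality of the proximal step at the updated dual variable: the last
displacement of `z` is the perturbation of the exact stationarity condition. -/
theorem variational (H : HalfSpaceSplitting K F a ρ xs x z τ) (k : ℕ) {y : E} (hy : y ∈ K) :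
    F (x (k + 1)) ≤ F y +
      ρ * ⟪τ (k + 1) • a + (z (k + 1) - z k), y - x (k + 1)⟫ := by
  have h : x (k + 1) - z k + τ k • a = τ (k + 1) • a + (z (k + 1) - z k) := by
    have := H.dual k
    rw [sub_smul] at this
    rw [← sub_eq_zero] at this ⊢
    rw [← this]; module
  rw [← h]
  exact H.prox k y hy

/-- Complementary slackness: the dual error is monotone in the primal error. -/
theorem dual_mul_slack_nonneg (H : HalfSpaceSplitting K F a ρ xs x z τ) {σ : ℝ} (hσ : 0 ≤ σ)
    (k : ℕ) : 0 ≤ (τ k - σ) * ⟪a, z k - xs⟫ := by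
  have h1 := H.slack k
  have h2 := mul_nonneg hσ (neg_nonneg.2 (H.half k))
  linarith

/-- The saddle-point inequality that compares an iterate with a primal-dual solution. -/
theorem saddle (H : HalfSpaceSplitting K F a ρ xs x z τ) (hxs : xs ∈ K) {σ g : ℝ} (k : ℕ)
    (hg : F xs + g ≤ F (x (k + 1)) + ρ * σ * ⟪a, x (k + 1) - xs⟫) :
    g + ρ * ((τ (k + 1) - σ) * ⟪a, x (k + 1) - xs⟫)
      + ρ * ⟪z (k + 1) - z k, x (k + 1) - xs⟫ ≤ 0 := by
  have h1 := H.variational k hxs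
  have h2 : xs - x (k + 1) = -(x (k + 1) - xs) := by abel
  rw [h2, inner_neg_right, inner_add_left, inner_smul_left] at h1
  simp only [conj_trivial] at h1
  linarith

/-- One step decreases the Lyapunov function by the squared step lengths. The gain `g` stands
for the growth of the Lagrangian at the new iterate. -/
theorem lyapunov_step (H : HalfSpaceSplitting K F a ρ xs x z τ) (hρ : 0 < ρ) (hxs : xs ∈ K)
    {σ g : ℝ} (hσ : 0 ≤ σ) (k : ℕ)
    (hg : F xs + g ≤ F (x (k + 1)) + ρ * σ * ⟪a, x (k + 1) - xs⟫) :
    lyapunov a xs σ (z (k + 1)) (τ (k + 1)) + ‖z (k + 1) - z k‖ ^ 2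
      + ‖a‖ ^ 2 * (τ (k + 1) - τ k) ^ 2 + 2 * g / ρ ≤ lyapunov a xs σ (z k) (τ k) := by
  have h1 := H.saddle hxs k hg
  have hx : x (k + 1) - xs = (z (k + 1) - xs) + (τ (k + 1) - τ k) • a := by
    rw [← H.dual k]; abel
  have haa : ⟪a, a⟫ = ‖a‖ ^ 2 := real_inner_self_eq_norm_sq a
  have h2 := H.dual_mul_slack_nonneg hσ (k + 1)
  -- monotonicity of the normal cone of the half-space between consecutive projections
  have h3 : 0 ≤ (τ (k + 1) - τ k) * ⟪z (k + 1) - z k, a⟫ := by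
    have e1 := H.dual_mul_slack_nonneg (H.dual_nonneg k) (k + 1)
    have e2 := H.dual_mul_slack_nonneg (H.dual_nonneg (k + 1)) k
    have e3 : ⟪z (k + 1) - z k, a⟫ = ⟪a, z (k + 1) - xs⟫ - ⟪a, z k - xs⟫ := by
      rw [← inner_sub_right, real_inner_comm]; congr 1; abel
    rw [e3]; linarith
  have h4 : ‖z k - xs‖ ^ 2 = ‖z (k + 1) - xs‖ ^ 2
      - 2 * ⟪z (k + 1) - z k, z (k + 1) - xs⟫ + ‖z (k + 1) - z k‖ ^ 2 := by
    have : z k - xs = (z (k + 1) - xs) - (z (k + 1) - z k) := by abel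
    rw [this, norm_sub_sq_real, real_inner_comm]
  rw [hx, inner_add_right, inner_add_right, inner_smul_right, inner_smul_right, haa] at h1
  have h5 : 2 * g / ρ + 2 * ((τ (k + 1) - σ) * (τ (k + 1) - τ k) * ‖a‖ ^ 2)
      + 2 * ⟪z (k + 1) - z k, z (k + 1) - xs⟫ ≤ 0 := by
    have h6 : g + ρ * ((τ (k + 1) - σ) * (τ (k + 1) - τ k) * ‖a‖ ^ 2)
      + ρ * ⟪z (k + 1) - z k, z (k + 1) - xs⟫ ≤ 0 := by
      nlinarith [mul_nonneg hρ.le h2, mul_nonneg hρ.le h3]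
    have h7 : 2 * g / ρ + 2 * ((τ (k + 1) - σ) * (τ (k + 1) - τ k) * ‖a‖ ^ 2)
      + 2 * ⟪z (k + 1) - z k, z (k + 1) - xs⟫ = 2 / ρ * (g + ρ * ((τ (k + 1) - σ) *
        (τ (k + 1) - τ k) * ‖a‖ ^ 2) + ρ * ⟪z (k + 1) - z k, z (k + 1) - xs⟫) := by
      field_simp
    rw [h7]
    exact mul_nonpos_of_nonneg_of_nonpos (by positivity) h6
  unfold lyapunov
  nlinarith

theorem lyapunov_antitone (H : HalfSpaceSplitting K F a ρ xs x z τ) (hρ : 0 < ρ) (hxs : xs ∈ K)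
    {σ : ℝ} (hσ : IsScaledMultiplier K F a ρ xs σ) :
    Antitone fun k => lyapunov a xs σ (z k) (τ k) := by
  refine antitone_nat_of_succ_le fun k => ?_
  have h := H.lyapunov_step (g := 0) hρ hxs hσ.1 k (by simpa using hσ.2 _ (H.mem k))
  have : 0 ≤ ‖a‖ ^ 2 * (τ (k + 1) - τ k) ^ 2 := by positivity
  have : 0 ≤ ‖z (k + 1) - z k‖ ^ 2 := by positivity
  simp only [mul_zero, zero_div] at h
  linarith

/-- A run is bounded, as the Lyapunov function of one multiplier decreases along it. -/
theorem bounded (H : HalfSpaceSplitting K F a ρ xs x z τ) (hρ : 0 < ρ) (hxs : xs ∈ K)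
    {σ : ℝ} (hσ : IsScaledMultiplier K F a ρ xs σ) :
    ∃ R : ℝ, 0 ≤ R ∧ ∀ k, ‖x (k + 1) - xs‖ ≤ R ∧ ‖z k - xs‖ ≤ R ∧ ‖τ k • a‖ ≤ R := by
  set B := Real.sqrt (lyapunov a xs σ (z 0) (τ 0)) with hB
  have hB0 : 0 ≤ B := Real.sqrt_nonneg _
  have hV : ∀ k, lyapunov a xs σ (z k) (τ k) ≤ B ^ 2 := fun k => by
    rw [hB, Real.sq_sqrt (lyapunov_nonneg ..)]
    exact H.lyapunov_antitone hρ hxs hσ (Nat.zero_le k)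
  have h1 : ∀ k, ‖z k - xs‖ ≤ B := fun k => by
    refine abs_le_of_sq_le_sq' ?_ hB0 |>.2
    have := hV k
    unfold lyapunov at this
    nlinarith [mul_nonneg (sq_nonneg ‖a‖) (sq_nonneg (τ k - σ))]
  have h2 : ∀ k, ‖(τ k - σ) • a‖ ≤ B := fun k => by
    refine abs_le_of_sq_le_sq' ?_ hB0 |>.2
    have := hV k
    unfold lyapunov at this
    rw [norm_smul, mul_pow, Real.norm_eq_abs, sq_abs]
    nlinarith [sq_nonneg ‖z k - xs‖]
  refine ⟨3 * B + ‖σ • a‖, by positivity, fun k => ⟨?_, ?_, ?_⟩⟩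
  · have e : x (k + 1) - xs = (z (k + 1) - xs) + ((τ (k + 1) - σ) • a - (τ k - σ) • a) := by
      have := H.dual k
      rw [← sub_smul, show τ (k + 1) - σ - (τ k - σ) = τ (k + 1) - τ k by ring, ← this]; abel
    rw [e]
    have := norm_add_le (z (k + 1) - xs) ((τ (k + 1) - σ) • a - (τ k - σ) • a)
    have := norm_sub_le ((τ (k + 1) - σ) • a) ((τ k - σ) • a)
    linarith [h1 (k + 1), h2 (k + 1), h2 k, norm_nonneg (σ • a)]
  · linarith [h1 k, norm_nonneg (σ • a)]
  · have e : τ k • a = (τ k - σ) • a + σ • a := by module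
    rw [e]
    linarith [norm_add_le ((τ k - σ) • a) (σ • a), h2 k]

/-- If the Lagrangian grows quadratically on bounded sets, the primal iterates converge: the
growth is summable along the run. -/
theorem tendsto (H : HalfSpaceSplitting K F a ρ xs x z τ) (hρ : 0 < ρ) (hxs : xs ∈ K)
    {σ : ℝ} (hσ : IsScaledMultiplier K F a ρ xs σ) {c : ℝ} (hc : 0 < c)
    (hgrow : ∀ k, F xs + c * ‖x (k + 1) - xs‖ ^ 2 ≤
      F (x (k + 1)) + ρ * σ * ⟪a, x (k + 1) - xs⟫) :
    Tendsto (fun k => ‖x (k + 1) - xs‖) atTop (𝓝 0) := by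
  obtain ⟨l, hl⟩ : ∃ l, Tendsto (fun k => lyapunov a xs σ (z k) (τ k)) atTop (𝓝 l) :=
    ⟨_, tendsto_atTop_ciInf (H.lyapunov_antitone hρ hxs hσ)
      ⟨0, by rintro _ ⟨k, rfl⟩; exact lyapunov_nonneg ..⟩⟩
  have h1 : Tendsto (fun k => ρ / (2 * c) * (lyapunov a xs σ (z k) (τ k)
      - lyapunov a xs σ (z (k + 1)) (τ (k + 1)))) atTop (𝓝 0) := by
    simpa using (hl.sub (hl.comp (tendsto_add_atTop_nat 1))).const_mul (ρ / (2 * c))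
  have h2 : Tendsto (fun k => ‖x (k + 1) - xs‖ ^ 2) atTop (𝓝 0) := by
    refine squeeze_zero (fun k => sq_nonneg _) (fun k => ?_) h1
    have h := H.lyapunov_step hρ hxs hσ.1 k (hgrow k)
    have : 0 ≤ ‖a‖ ^ 2 * (τ (k + 1) - τ k) ^ 2 := by positivity
    have : 0 ≤ ‖z (k + 1) - z k‖ ^ 2 := by positivity
    have h3 : 2 * (c * ‖x (k + 1) - xs‖ ^ 2) / ρ ≤ lyapunov a xs σ (z k) (τ k)
      - lyapunov a xs σ (z (k + 1)) (τ (k + 1)) := by linarith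
    calc ‖x (k + 1) - xs‖ ^ 2
        = ρ / (2 * c) * (2 * (c * ‖x (k + 1) - xs‖ ^ 2) / ρ) := by field_simp
      _ ≤ _ := by gcongr
  simpa [Function.comp_def, Real.sqrt_sq (norm_nonneg _)] using
    (Real.continuous_sqrt.tendsto 0).comp h2

end HalfSpaceSplitting

theorem le_mul_of_sq_le {m p q X e : ℝ} (hm : 0 < m) (hp : 0 ≤ p) (hq : 0 ≤ q) (he : 0 ≤ e)
    (h : m * X ^ 2 ≤ p * (e * X) + q * e ^ 2) : X ≤ ((p + q) / m + 1) * e := by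
  by_contra! hlt
  set r := (p + q) / m + 1 with hr
  have hr1 : 1 ≤ r := by
    have : 0 ≤ (p + q) / m := by positivity
    linarith
  have hmr : m * r = p + q + m := by rw [hr]; field_simp
  have heX : e ≤ X := by nlinarith
  have hX : 0 < X := by nlinarith
  have h1 : (p + q + m) * e * X < m * X * X := by
    have := mul_lt_mul_of_pos_left hlt (mul_pos hm hX)
    calc (p + q + m) * e * X = m * X * (r * e) := by rw [← hmr]; ring
      _ < _ := this
  have h2 : q * e ^ 2 ≤ q * (e * X) := by
    rw [sq]; exact mul_le_mul_of_nonneg_left (mul_le_mul_of_nonneg_left heX he) hq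
  have h3 : 0 ≤ m * (e * X) := by positivity
  linarith

/-- A nonnegative sequence dominated by its own decrements decays geometrically. The bound is
stated as a square, for sequences of squared distances. -/
theorem exists_geometric_bound {D : ℕ → ℝ} {M : ℝ} {k₀ : ℕ} (hD0 : ∀ k, 0 ≤ D k) (hM0 : 0 ≤ M)
    (hD : ∀ k, k₀ ≤ k → D (k + 1) ≤ M * (D k - D (k + 1))) :
    ∃ C q : ℝ, 0 ≤ C ∧ 0 ≤ q ∧ q < 1 ∧ ∀ k, k₀ ≤ k → D k ≤ (C * q ^ k) ^ 2 := by
  set s := M / (M + 1) with hs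
  have hs0 : 0 ≤ s := by positivity
  have hs1 : s < 1 := (div_lt_one (by positivity)).2 (by linarith)
  have hgeo : ∀ j, D (k₀ + j) ≤ s ^ j * D k₀ := by
    intro j
    induction j with
    | zero => simp
    | succ j ih =>
      calc D (k₀ + (j + 1)) ≤ s * D (k₀ + j) := by
            have h1 := hD (k₀ + j) (by omega)
            rw [hs, div_mul_eq_mul_div, le_div_iff₀ (by positivity), ← add_assoc]
            linarith
        _ ≤ s * (s ^ j * D k₀) := by gcongr
        _ = _ := by ring
  -- a rate `q` between `√s` and `1` that does not vanish, so that `q ^ k₀` can be divided out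
  set q := (1 + Real.sqrt s) / 2 with hq
  have hq0 : 0 < q := by positivity
  have hsq : Real.sqrt s < 1 := by
    rw [Real.sqrt_lt' one_pos]; simpa using hs1
  have hsq2 : s ≤ q ^ 2 := by
    calc s = Real.sqrt s ^ 2 := (Real.sq_sqrt hs0).symm
      _ ≤ q ^ 2 := pow_le_pow_left₀ (Real.sqrt_nonneg _) (by rw [hq]; linarith) 2
  refine ⟨Real.sqrt (D k₀) / q ^ k₀, q, by positivity, hq0.le, by rw [hq]; linarith,
    fun k hk => ?_⟩
  obtain ⟨j, rfl⟩ := Nat.exists_eq_add_of_le hk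
  have h1 : Real.sqrt (D k₀) / q ^ k₀ * q ^ (k₀ + j) = Real.sqrt (D k₀) * q ^ j := by
    rw [pow_add]; field_simp
  rw [h1, mul_pow, Real.sq_sqrt (hD0 _), ← pow_mul, mul_comm j 2, pow_mul]
  calc _ ≤ s ^ j * D k₀ := hgeo j
    _ ≤ (q ^ 2) ^ j * D k₀ :=
      mul_le_mul_of_nonneg_right (pow_le_pow_left₀ hs0 hsq2 j) (hD0 _)
    _ = _ := mul_comm _ _

/-- A dual error bound controls the primal error by the lengths of the last step. -/
theorem HalfSpaceSplitting.primal_error (H : HalfSpaceSplitting K F a ρ xs x z τ) (hρ : 0 < ρ)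
    (hxs : xs ∈ K) {σ c κ : ℝ} (hσ : 0 ≤ σ) (hc : 0 < c) (hκ : 0 ≤ κ) (k : ℕ)
    (hgrow : F xs + c * ‖x (k + 1) - xs‖ ^ 2 ≤
      F (x (k + 1)) + ρ * σ * ⟪a, x (k + 1) - xs⟫)
    (hd : |τ (k + 1) - σ| ≤ κ * (‖x (k + 1) - xs‖ + ‖z (k + 1) - z k‖)) :
    ‖x (k + 1) - xs‖ ≤ ((κ * ‖a‖ * ρ + ρ + κ * ‖a‖ * ρ) / c + 1) *
      (‖z (k + 1) - z k‖ + ‖(τ (k + 1) - τ k) • a‖) := by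
  have h1 := H.saddle hxs k hgrow
  have h2 : ⟪a, x (k + 1) - xs⟫ =
      ⟪a, z (k + 1) - xs⟫ + ⟪a, (τ (k + 1) - τ k) • a⟫ := by
    rw [← inner_add_right, ← H.dual k]; congr 1; abel
  have h3 := H.dual_mul_slack_nonneg hσ (k + 1)
  have h4 : -(κ * (‖x (k + 1) - xs‖ + ‖z (k + 1) - z k‖) *
      (‖a‖ * ‖(τ (k + 1) - τ k) • a‖)) ≤ (τ (k + 1) - σ) * ⟪a, (τ (k + 1) - τ k) • a⟫ := by
    refine (abs_le.1 ?_).1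
    rw [abs_mul]
    exact mul_le_mul hd (abs_real_inner_le_norm _ _) (abs_nonneg _)
      (le_trans (abs_nonneg _) hd)
  have h5 : -(‖z (k + 1) - z k‖ * ‖x (k + 1) - xs‖) ≤
      ⟪z (k + 1) - z k, x (k + 1) - xs⟫ := (abs_le.1 (abs_real_inner_le_norm _ _)).1
  rw [h2, mul_add, mul_add] at h1
  have h7 := mul_le_mul_of_nonneg_left h4 hρ.le
  have h8 := mul_le_mul_of_nonneg_left h5 hρ.le
  have h9 := mul_nonneg hρ.le h3
  clear h2 h3 h4 h5 hd hgrow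
  generalize ⟪z (k + 1) - z k, x (k + 1) - xs⟫ = i₁ at *
  generalize (τ (k + 1) - σ) * ⟪a, (τ (k + 1) - τ k) • a⟫ = i₂ at *
  generalize (τ (k + 1) - σ) * ⟪a, z (k + 1) - xs⟫ = i₃ at *
  have hX0 : 0 ≤ ‖x (k + 1) - xs‖ := norm_nonneg _
  have hE1 : 0 ≤ ‖z (k + 1) - z k‖ := norm_nonneg _
  have hE2 : 0 ≤ ‖(τ (k + 1) - τ k) • a‖ := norm_nonneg _
  have hA : 0 ≤ ‖a‖ := norm_nonneg _
  generalize ‖x (k + 1) - xs‖ = X at *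
  generalize ‖z (k + 1) - z k‖ = e₁ at *
  generalize ‖(τ (k + 1) - τ k) • a‖ = e₂ at *
  generalize ‖a‖ = A at *
  refine le_mul_of_sq_le hc (by positivity) (by positivity) (by positivity) ?_
  have i1 : ρ * (κ * (X + e₁) * (A * e₂)) =
      κ * A * ρ * (e₂ * X) + κ * A * ρ * (e₁ * e₂) := by ring
  have i2 : κ * A * ρ * (e₂ * X) ≤ κ * A * ρ * ((e₁ + e₂) * X) := by
    gcongr; linarith
  have i3 : κ * A * ρ * (e₁ * e₂) ≤ κ * A * ρ * (e₁ + e₂) ^ 2 := by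
    gcongr; nlinarith
  have i4 : ρ * (e₁ * X) ≤ ρ * ((e₁ + e₂) * X) := by gcongr; linarith
  have i5 : (κ * A * ρ + ρ) * ((e₁ + e₂) * X) =
      κ * A * ρ * ((e₁ + e₂) * X) + ρ * ((e₁ + e₂) * X) := by ring
  rw [i5]
  linarith

/-- **Linear convergence from a dual error bound.** `π` is a projection onto a set of
multipliers. If the Lagrangian grows quadratically on bounded sets and near the solution the
dual error is controlled by the primal error and the last step, then the distance to the
solution set decays geometrically. -/
theorem HalfSpaceSplitting.linear_rate (H : HalfSpaceSplitting K F a ρ xs x z τ) (hρ : 0 < ρ)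
    (hxs : xs ∈ K) {π : ℝ → ℝ} (hπ : ∀ σ, IsScaledMultiplier K F a ρ xs (π σ))
    (hproj : ∀ σ σ', |σ - π σ| ≤ |σ - π σ'|)
    (hgrow : ∀ R : ℝ, 0 ≤ R → ∃ c : ℝ, 0 < c ∧ ∀ σ, ∀ y ∈ K, ‖y - xs‖ ≤ R →
      F xs + c * ‖y - xs‖ ^ 2 ≤ F y + ρ * π σ * ⟪a, y - xs⟫)
    (herr : ∃ r κ : ℝ, 0 < r ∧ 0 ≤ κ ∧ ∀ y ∈ K, ‖y - xs‖ ≤ r → ∀ (σ : ℝ) (e : E), 0 ≤ σ →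
      (∀ v ∈ K, F y ≤ F v + ρ * ⟪σ • a + e, v - y⟫) →
      |σ - π σ| ≤ κ * (‖y - xs‖ + ‖e‖)) :
    ∃ C q : ℝ, 0 ≤ q ∧ q < 1 ∧ ∀ᶠ k in atTop,
      ‖x (k + 1) - xs‖ ≤ C * q ^ k ∧ ‖z (k + 1) - xs‖ ≤ C * q ^ k := by
  obtain ⟨R, hR0, hR⟩ := H.bounded hρ hxs (hπ 0)
  obtain ⟨c, hc, hgr⟩ := hgrow R hR0
  have hgr' : ∀ σ k, F xs + c * ‖x (k + 1) - xs‖ ^ 2 ≤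
      F (x (k + 1)) + ρ * π σ * ⟪a, x (k + 1) - xs⟫ :=
    fun σ k => hgr σ _ (H.mem k) (hR k).1
  obtain ⟨r, κ, hr, hκ, herr⟩ := herr
  have hlim := H.tendsto hρ hxs (hπ 0) hc (hgr' 0)
  set e₁ : ℕ → ℝ := fun k => ‖z (k + 1) - z k‖ with he₁
  set e₂ : ℕ → ℝ := fun k => ‖(τ (k + 1) - τ k) • a‖ with he₂
  have hev : ∀ᶠ k in atTop, ‖x (k + 1) - xs‖ ≤ r :=
    (hlim.eventually (gt_mem_nhds hr)).mono fun k hk => hk.le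
  set A := ‖a‖
  set m := (κ * A * ρ + ρ + κ * A * ρ) / c + 1
  have hm0 : 0 ≤ m := by positivity
  have hX : ∀ k, ‖x (k + 1) - xs‖ ≤ r → ‖x (k + 1) - xs‖ ≤ m * (e₁ k + e₂ k) ∧
      |τ (k + 1) - π (τ (k + 1))| ≤ κ * (‖x (k + 1) - xs‖ + e₁ k) := by
    intro k hk
    have hd := herr _ (H.mem k) hk (τ (k + 1)) (z (k + 1) - z k) (H.dual_nonneg _)
      fun v hv => H.variational k hv
    exact ⟨H.primal_error hρ hxs (hπ _).1 hc hκ k (hgr' _ k) hd, hd⟩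
  -- the squared distance to the set of primal-dual solutions
  set D : ℕ → ℝ := fun k => lyapunov a xs (π (τ k)) (z k) (τ k) with hD
  have hD0 : ∀ k, 0 ≤ D k := fun k => lyapunov_nonneg ..
  have hstep : ∀ k, D (k + 1) + (e₁ k ^ 2 + e₂ k ^ 2) ≤ D k := by
    intro k
    have h1 := H.lyapunov_step (g := 0) hρ hxs (hπ (τ k)).1 k
      (by simpa using (hπ (τ k)).2 _ (H.mem k))
    have h2 : D (k + 1) ≤ lyapunov a xs (π (τ k)) (z (k + 1)) (τ (k + 1)) := by
      simp only [hD, lyapunov]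
      have := sq_le_sq.2 (hproj (τ (k + 1)) (τ k))
      gcongr
    have h3 : e₂ k ^ 2 = ‖a‖ ^ 2 * (τ (k + 1) - τ k) ^ 2 := by
      simp only [he₂, norm_smul, Real.norm_eq_abs, mul_pow, sq_abs]; ring
    simp only [mul_zero, zero_div, add_zero] at h1
    rw [h3]
    linarith
  set M := 2 * ((m + 1) ^ 2 + (A * (κ * (m + 1))) ^ 2) with hM
  have hM0 : 0 ≤ M := by positivity
  have hDM : ∀ k, ‖x (k + 1) - xs‖ ≤ r → D (k + 1) ≤ M * (e₁ k ^ 2 + e₂ k ^ 2) := by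
    intro k hk
    obtain ⟨h1, h2⟩ := hX k hk
    have hE1 : 0 ≤ e₁ k := norm_nonneg _
    have hE2 : 0 ≤ e₂ k := norm_nonneg _
    have hz : ‖z (k + 1) - xs‖ ≤ (m + 1) * (e₁ k + e₂ k) := by
      have : z (k + 1) - xs = (x (k + 1) - xs) - (τ (k + 1) - τ k) • a := by
        rw [← H.dual k]; abel
      rw [this]
      have := norm_sub_le (x (k + 1) - xs) ((τ (k + 1) - τ k) • a)
      simp only [he₂] at *
      linarith
    have ht : A * |τ (k + 1) - π (τ (k + 1))| ≤ A * (κ * (m + 1)) * (e₁ k + e₂ k) := by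
      rw [mul_assoc]
      refine mul_le_mul_of_nonneg_left (h2.trans ?_) (norm_nonneg _)
      rw [mul_assoc]
      refine mul_le_mul_of_nonneg_left ?_ hκ
      linarith
    have hz2 := pow_le_pow_left₀ (norm_nonneg _) hz 2
    have ht2 := pow_le_pow_left₀ (by positivity) ht 2
    rw [mul_pow A, sq_abs] at ht2
    have hs : (e₁ k + e₂ k) ^ 2 ≤ 2 * (e₁ k ^ 2 + e₂ k ^ 2) := by
      nlinarith [sq_nonneg (e₁ k - e₂ k)]
    calc D (k + 1) ≤ ((m + 1) * (e₁ k + e₂ k)) ^ 2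
          + (A * (κ * (m + 1)) * (e₁ k + e₂ k)) ^ 2 := by
          simp only [hD, lyapunov]; exact add_le_add hz2 ht2
      _ = ((m + 1) ^ 2 + (A * (κ * (m + 1))) ^ 2) * (e₁ k + e₂ k) ^ 2 := by ring
      _ ≤ ((m + 1) ^ 2 + (A * (κ * (m + 1))) ^ 2) * (2 * (e₁ k ^ 2 + e₂ k ^ 2)) := by gcongr
      _ = _ := by rw [hM]; ring
  obtain ⟨k₀, hk₀⟩ := eventually_atTop.1 hev
  obtain ⟨C, q, hC, hq0, hq1, hgeo⟩ := exists_geometric_bound hD0 hM0 (k₀ := k₀) fun k hk =>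
    (hDM k (hk₀ k hk)).trans (mul_le_mul_of_nonneg_left (by linarith [hstep k]) hM0)
  refine ⟨(2 * m + 1) * C, q, hq0, hq1, eventually_atTop.2 ⟨k₀, fun k hk => ?_⟩⟩
  have hDk := hgeo k hk
  set w := C * q ^ k with hw
  have hw0 : 0 ≤ w := by positivity
  have h1 := hstep k
  have h2 := hD0 (k + 1)
  have hE1 : e₁ k ≤ w := (abs_le_of_sq_le_sq' (by nlinarith [sq_nonneg (e₂ k)]) hw0).2
  have hE2 : e₂ k ≤ w := (abs_le_of_sq_le_sq' (by nlinarith [sq_nonneg (e₁ k)]) hw0).2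
  have hxk : ‖x (k + 1) - xs‖ ≤ 2 * m * w := by
    refine (hX k (hk₀ k hk)).1.trans ?_
    calc m * (e₁ k + e₂ k) ≤ m * (w + w) := by gcongr
      _ = _ := by ring
  rw [mul_assoc, ← hw]
  refine ⟨by linarith, ?_⟩
  have : z (k + 1) - xs = (x (k + 1) - xs) - (τ (k + 1) - τ k) • a := by
    rw [← H.dual k]; abel
  rw [this]
  have := norm_sub_le (x (k + 1) - xs) ((τ (k + 1) - τ k) • a)
  simp only [he₂] at hE2
  linarith

/-- The objective error is dominated by the primal error. -/
theorem HalfSpaceSplitting.objective_error (H : HalfSpaceSplitting K F a ρ xs x z τ)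
    (hρ : 0 < ρ) (hxs : xs ∈ K) {σ : ℝ} (hσ : IsScaledMultiplier K F a ρ xs σ) :
    ∃ B : ℝ, 0 ≤ B ∧ ∀ k, |F (x (k + 1)) - F xs| ≤ B * ‖x (k + 1) - xs‖ := by
  obtain ⟨R, hR0, hR⟩ := H.bounded hρ hxs hσ
  have hσ0 := hσ.1
  refine ⟨ρ * (3 * R) + ρ * σ * ‖a‖, by positivity, fun k => abs_le.2 ⟨?_, ?_⟩⟩
  · have h1 := hσ.2 _ (H.mem k)
    have h2 : ρ * σ * ⟪a, x (k + 1) - xs⟫ ≤ ρ * σ * (‖a‖ * ‖x (k + 1) - xs‖) :=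
      mul_le_mul_of_nonneg_left (real_inner_le_norm _ _) (by positivity)
    have h3 : 0 ≤ ρ * (3 * R) * ‖x (k + 1) - xs‖ := by positivity
    linarith
  · have h1 := H.variational k hxs
    have h2 : ρ * ⟪τ (k + 1) • a + (z (k + 1) - z k), xs - x (k + 1)⟫ ≤
        ρ * (3 * R * ‖x (k + 1) - xs‖) := by
      refine mul_le_mul_of_nonneg_left ((real_inner_le_norm _ _).trans ?_) hρ.le
      rw [norm_sub_rev xs]
      gcongr
      have e : z (k + 1) - z k = (z (k + 1) - xs) - (z k - xs) := by abel
      have := norm_add_le (τ (k + 1) • a) (z (k + 1) - z k)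
      have := norm_sub_le (z (k + 1) - xs) (z k - xs)
      rw [← e] at this
      linarith [(hR k).2.1, (hR (k + 1)).2.1, (hR (k + 1)).2.2]
    have h3 : 0 ≤ ρ * σ * ‖a‖ * ‖x (k + 1) - xs‖ := by positivity
    linarith

/-- A geometric bound that holds eventually, up to a shift of the index, yields a bound `C / t`
for all `t ≥ 1`. -/
theorem exists_le_div_of_eventually_geometric {u : ℕ → ℝ} {C q : ℝ} (j : ℕ) (hu : ∀ k, 0 ≤ u k)
    (hq0 : 0 ≤ q) (hq1 : q < 1) (h : ∀ᶠ k in atTop, u (k + j) ≤ C * q ^ k) :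
    ∃ B : ℝ, ∀ t : ℕ, 1 ≤ t → u t ≤ B / t := by
  have h1 : Tendsto (fun k : ℕ => C * ((k : ℝ) * q ^ k) + j * C * q ^ k) atTop (𝓝 0) := by
    simpa using ((tendsto_self_mul_const_pow_of_lt_one hq0 hq1).const_mul C).add
      ((tendsto_pow_atTop_nhds_zero_of_lt_one hq0 hq1).const_mul (j * C))
  have h2 : Tendsto (fun k : ℕ => (k : ℝ) * u k) atTop (𝓝 0) := by
    refine (tendsto_add_atTop_iff_nat j).1 (squeeze_zero' (Eventually.of_forall fun k =>
      mul_nonneg (Nat.cast_nonneg _) (hu _)) (h.mono fun k hk => ?_) h1)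
    calc ((k + j : ℕ) : ℝ) * u (k + j) ≤ (k + j : ℕ) * (C * q ^ k) := by gcongr
      _ = _ := by push_cast; ring
  obtain ⟨B, hB⟩ := h2.bddAbove_range
  refine ⟨B, fun t ht => ?_⟩
  rw [le_div_iff₀ (by exact_mod_cast ht), mul_comm]
  exact hB ⟨t, rfl⟩

end Abstract

/-! ### The reciprocal function -/

section Reciprocal

/-- The tangent line of the reciprocal, with its exact quadratic remainder. -/
theorem one_div_eq_tangent {m u : ℝ} (hm : 0 < m) (hu : 0 < u) :
    1 / u = 1 / m - (u - m) / m ^ 2 + (u - m) ^ 2 / (m ^ 2 * u) := by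
  field_simp; ring

theorem one_div_ge_tangent {m u : ℝ} (hm : 0 < m) (hu : 0 < u) :
    1 / m - (u - m) / m ^ 2 ≤ 1 / u := by
  have : 0 ≤ (u - m) ^ 2 / (m ^ 2 * u) := by positivity
  linarith [one_div_eq_tangent hm hu]

theorem one_div_combo_le {u v α β : ℝ} (hu : 0 < u) (hv : 0 < v) (hα : 0 ≤ α) (hβ : 0 ≤ β)
    (h : α + β = 1) : 1 / (α * u + β * v) ≤ α * (1 / u) + β * (1 / v) := by
  have hm : 0 < α * u + β * v := by
    rcases hα.eq_or_lt with rfl | hα'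
    · have : β = 1 := by linarith
      subst this; linarith
    · have := mul_pos hα' hu; have := mul_nonneg hβ hv.le; linarith
  set m := α * u + β * v with hmdef
  have h1 := mul_le_mul_of_nonneg_left (one_div_ge_tangent hm hu) hα
  have h2 := mul_le_mul_of_nonneg_left (one_div_ge_tangent hm hv) hβ
  have h3 : α * (1 / m - (u - m) / m ^ 2) + β * (1 / m - (v - m) / m ^ 2) = 1 / m := by
    have : α * (1 / m - (u - m) / m ^ 2) + β * (1 / m - (v - m) / m ^ 2) =
        (α + β) * (1 / m) - (α * u + β * v - (α + β) * m) / m ^ 2 := by ring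
    rw [this, h, ← hmdef]; simp
  linarith

theorem one_div_midpoint_le {u v B : ℝ} (hu : 0 < u) (hv : 0 < v) (huB : u ≤ B) (hvB : v ≤ B) :
    1 / (1 / 2 * u + 1 / 2 * v) + (u - v) ^ 2 / (4 * B ^ 3) ≤
      1 / 2 * (1 / u) + 1 / 2 * (1 / v) := by
  have hm : 0 < 1 / 2 * u + 1 / 2 * v := by positivity
  have hmB : 1 / 2 * u + 1 / 2 * v ≤ B := by linarith
  have hB : 0 < B := hu.trans_le huB
  have h1 := one_div_eq_tangent hm hu
  have h2 := one_div_eq_tangent hm hv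
  have key : ∀ w : ℝ, 0 < w → w ≤ B → (w - (1 / 2 * u + 1 / 2 * v)) ^ 2 / B ^ 3 ≤
      (w - (1 / 2 * u + 1 / 2 * v)) ^ 2 / ((1 / 2 * u + 1 / 2 * v) ^ 2 * w) := by
    intro w hw hwB
    refine div_le_div_of_nonneg_left (sq_nonneg _) (by positivity) ?_
    calc (1 / 2 * u + 1 / 2 * v) ^ 2 * w ≤ B ^ 2 * B := by gcongr
      _ = B ^ 3 := by ring
  have h3 := key u hu huB
  have h4 := key v hv hvB
  set m := 1 / 2 * u + 1 / 2 * v with hmdef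
  have h5 : (u - m) ^ 2 / B ^ 3 + (v - m) ^ 2 / B ^ 3 = 2 * ((u - v) ^ 2 / (4 * B ^ 3)) := by
    rw [hmdef]; field_simp; ring
  have h6 : (u - m) / m ^ 2 + (v - m) / m ^ 2 = 0 := by rw [hmdef]; ring
  linarith

theorem abs_inv_sq_sub_le {u v : ℝ} (hu : 0 < u) (h : |v - u| ≤ u / 2) :
    |(1 / v) ^ 2 - (1 / u) ^ 2| ≤ 10 / u ^ 3 * |v - u| := by
  obtain ⟨h1, h2⟩ := abs_le.1 h
  have hv : 0 < v := by linarith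
  have e : (1 / v) ^ 2 - (1 / u) ^ 2 = (u + v) / (v ^ 2 * u ^ 2) * (u - v) := by
    field_simp; ring
  rw [e, abs_mul, abs_of_pos (by positivity : 0 < (u + v) / (v ^ 2 * u ^ 2)), abs_sub_comm u v]
  refine mul_le_mul_of_nonneg_right ?_ (abs_nonneg _)
  -- the constant `10` comes from `u + v ≤ 5 u / 2` and `v ≥ u / 2`
  rw [div_le_div_iff₀ (by positivity) (by positivity)]
  have h3 : (u / 2) ^ 2 ≤ v ^ 2 := by gcongr; linarith
  have h4 : (u + v) * u ^ 3 ≤ (5 / 2 * u) * u ^ 3 := by gcongr; linarith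
  have h5 : (u / 2) ^ 2 * u ^ 2 ≤ v ^ 2 * u ^ 2 := by gcongr
  nlinarith

theorem sq_le_of_eventually_one_div_le {m w : ℝ} (hm : 0 < m)
    (h : ∀ᶠ ε in 𝓝[>] (0 : ℝ), 1 / (m * (m + ε)) ≤ w) : (1 / m) ^ 2 ≤ w := by
  have hc : ContinuousAt (fun ε : ℝ => 1 / (m * (m + ε))) 0 :=
    continuousAt_const.div (by fun_prop) (by simp [hm.ne'])
  have h1 : Tendsto (fun ε : ℝ => 1 / (m * (m + ε))) (𝓝[>] 0) (𝓝 ((1 / m) ^ 2)) := by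
    have := hc.tendsto.mono_left (nhdsWithin_le_nhds (s := Set.Ioi 0))
    convert this using 2
    rw [add_zero]; ring
  exact le_of_tendsto h1 h

theorem le_sq_of_eventually_le_one_div {m w : ℝ} (hm : 0 < m)
    (h : ∀ᶠ ε in 𝓝[>] (0 : ℝ), w ≤ 1 / (m * (m - ε))) : w ≤ (1 / m) ^ 2 := by
  have hc : ContinuousAt (fun ε : ℝ => 1 / (m * (m - ε))) 0 :=
    continuousAt_const.div (by fun_prop) (by simp [hm.ne'])
  have h1 : Tendsto (fun ε : ℝ => 1 / (m * (m - ε))) (𝓝[>] 0) (𝓝 ((1 / m) ^ 2)) := by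
    have := hc.tendsto.mono_left (nhdsWithin_le_nhds (s := Set.Ioi 0))
    convert this using 2
    rw [sub_zero]; ring
  exact ge_of_tendsto h1 h

end Reciprocal

/-! ### The slicing problem as a convex program -/

section Network

open scoped RealInnerProductSpace

variable {S N : ℕ}

/-- The normal vector of the half-space: `1` at every processing power and `0` at every
bandwidth. -/
noncomputable def powerNormal (S N : ℕ) : GlobalVec S N :=
  WithLp.toLp 2 fun _ => WithLp.toLp 2 (Sum.elim (fun _ => 0) fun _ => 1)

/-- The vector with the bandwidths of `x` and the processing powers `μ`. -/
noncomputable def withPower (x : GlobalVec S N) (μ : Fin S → Fin N → ℝ) : GlobalVec S N :=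
  WithLp.toLp 2 fun s => WithLp.toLp 2 (Sum.elim (bw (x s)) (μ s))

/-- The vector `x` with the single processing power `μ_{s₀n₀}` increased by `ε`. -/
noncomputable def shiftPower (x : GlobalVec S N) (s₀ : Fin S) (n₀ : Fin N) (ε : ℝ) :
    GlobalVec S N :=
  withPower x fun s n => pw (x s) n + if s = s₀ ∧ n = n₀ then ε else 0

@[simp] theorem bw_withPower (x : GlobalVec S N) (μ : Fin S → Fin N → ℝ) (s : Fin S)
    (n : Fin N) : bw (withPower x μ s) n = bw (x s) n := rfl

@[simp] theorem pw_withPower (x : GlobalVec S N) (μ : Fin S → Fin N → ℝ) (s : Fin S)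
    (n : Fin N) : pw (withPower x μ s) n = μ s n := rfl

@[simp] theorem bw_shiftPower (x : GlobalVec S N) (s₀ : Fin S) (n₀ : Fin N) (ε : ℝ) (s : Fin S)
    (n : Fin N) : bw (shiftPower x s₀ n₀ ε s) n = bw (x s) n := rfl

@[simp] theorem pw_shiftPower (x : GlobalVec S N) (s₀ : Fin S) (n₀ : Fin N) (ε : ℝ) (s : Fin S)
    (n : Fin N) : pw (shiftPower x s₀ n₀ ε s) n =
      pw (x s) n + if s = s₀ ∧ n = n₀ then ε else 0 := rfl

@[simp] theorem bw_add (v w : LocalVec N) (n : Fin N) : bw (v + w) n = bw v n + bw w n := rfl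
@[simp] theorem pw_add (v w : LocalVec N) (n : Fin N) : pw (v + w) n = pw v n + pw w n := rfl
@[simp] theorem bw_sub (v w : LocalVec N) (n : Fin N) : bw (v - w) n = bw v n - bw w n := rfl
@[simp] theorem pw_sub (v w : LocalVec N) (n : Fin N) : pw (v - w) n = pw v n - pw w n := rfl
@[simp] theorem bw_smul (c : ℝ) (v : LocalVec N) (n : Fin N) : bw (c • v) n = c * bw v n := rfl
@[simp] theorem pw_smul (c : ℝ) (v : LocalVec N) (n : Fin N) : pw (c • v) n = c * pw v n := rfl

theorem inner_eq_sum (x y : GlobalVec S N) :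
    ⟪x, y⟫ = ∑ s, ∑ n, (bw (x s) n * bw (y s) n + pw (x s) n * pw (y s) n) := by
  simp only [PiLp.inner_apply, Fintype.sum_sum_type, ← Finset.sum_add_distrib, bw, pw]
  simp [mul_comm]

theorem norm_sq_eq_sum (x : GlobalVec S N) :
    ‖x‖ ^ 2 = ∑ s, ∑ n, (bw (x s) n ^ 2 + pw (x s) n ^ 2) := by
  rw [← real_inner_self_eq_norm_sq, inner_eq_sum]
  simp only [sq]

theorem inner_powerNormal (x : GlobalVec S N) :
    ⟪powerNormal S N, x⟫ = ∑ s, ∑ n, pw (x s) n := by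
  rw [inner_eq_sum]
  have h1 : ∀ s n, bw (powerNormal S N s) n = 0 := fun _ _ => rfl
  have h2 : ∀ s n, pw (powerNormal S N s) n = 1 := fun _ _ => rfl
  simp [h1, h2]

theorem sum_sum_eq_single {G : Fin S → Fin N → ℝ} (s₀ : Fin S) (n₀ : Fin N)
    (h : ∀ s n, ¬(s = s₀ ∧ n = n₀) → G s n = 0) : ∑ s, ∑ n, G s n = G s₀ n₀ := by
  rw [Finset.sum_eq_single s₀, Finset.sum_eq_single n₀]
  · exact fun n _ hn => h _ _ fun h => hn h.2
  · simp
  · exact fun s _ hs => Finset.sum_eq_zero fun n _ => h _ _ fun h => hs h.1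
  · simp

theorem inner_shiftPower_sub (u x : GlobalVec S N) (s₀ : Fin S) (n₀ : Fin N) (ε : ℝ) :
    ⟪u, shiftPower x s₀ n₀ ε - x⟫ = ε * pw (u s₀) n₀ := by
  rw [inner_eq_sum, sum_sum_eq_single s₀ n₀]
  · simp; ring
  · intro s n h
    simp [h]

theorem abs_bw_le (x : GlobalVec S N) (s : Fin S) (n : Fin N) : |bw (x s) n| ≤ ‖x‖ :=
  (PiLp.norm_apply_le (x s) (Sum.inl n)).trans (PiLp.norm_apply_le x s)

theorem abs_pw_le (x : GlobalVec S N) (s : Fin S) (n : Fin N) : |pw (x s) n| ≤ ‖x‖ :=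
  (PiLp.norm_apply_le (x s) (Sum.inr n)).trans (PiLp.norm_apply_le x s)

variable (P : Network S N)

/-- The communication delay is `commCoeff / b`. -/
noncomputable def Network.commCoeff (s : Fin S) (n : Fin N) : ℝ :=
  P.d n / Real.log (1 + P.h s n * (P.w s n / P.σ s n))

/-- The product of the local feasible sets. -/
def Network.globalSet : Set (GlobalVec S N) := {x | ∀ s, x s ∈ P.localSet s}

namespace Network

theorem commCoeff_pos (s : Fin S) (n : Fin N) : 0 < P.commCoeff s n := by
  have h1 := P.h_pos s n
  have h2 := P.w_pos s n
  have h3 := P.σ_pos s n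
  exact div_pos (P.d_pos n) (Real.log_pos (by
    have : 0 < P.h s n * (P.w s n / P.σ s n) := by positivity
    linarith))

theorem respTime_eq (s : Fin S) (v : LocalVec N) (n : Fin N) :
    P.respTime s v n = P.commCoeff s n * (1 / bw v n) + 1 / (pw v n - P.rate s n) := by
  unfold respTime commDelay queueDelay commCoeff
  rw [mul_one_div, div_div, mul_comm (bw v n)]

variable {P}

theorem isFeasible_iff {x : GlobalVec S N} :
    P.IsFeasible x ↔ x ∈ P.globalSet ∧ ⟪powerNormal S N, x⟫ ≤ P.γ := by
  rw [inner_powerNormal]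
  constructor
  · rintro ⟨h1, h2, h3, h4, h5⟩
    exact ⟨fun s => ⟨h1 s, h2 s, h3 s, h4 s⟩, h5⟩
  · rintro ⟨h, h5⟩
    exact ⟨fun s => (h s).1, fun s => (h s).2.1, fun s => (h s).2.2.1,
      fun s => (h s).2.2.2, h5⟩

theorem bw_pos {x : GlobalVec S N} (hx : x ∈ P.globalSet) (s : Fin S) (n : Fin N) :
    0 < bw (x s) n := P.b₀_nonneg.trans_lt ((hx s).1 n)

theorem load_pos {x : GlobalVec S N} (hx : x ∈ P.globalSet) (s : Fin S) (n : Fin N) :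
    0 < pw (x s) n - P.rate s n := sub_pos.2 ((hx s).2.1 n)

theorem respTime_combo_le {v w : LocalVec N} {s : Fin S} {n : Fin N} (hv : 0 < bw v n)
    (hw : 0 < bw w n) (hv' : 0 < pw v n - P.rate s n) (hw' : 0 < pw w n - P.rate s n)
    {α β : ℝ} (hα : 0 ≤ α) (hβ : 0 ≤ β) (h : α + β = 1) :
    P.respTime s (α • v + β • w) n ≤ α * P.respTime s v n + β * P.respTime s w n := by
  simp only [respTime_eq, bw_add, pw_add, bw_smul, pw_smul]
  have h1 := mul_le_mul_of_nonneg_left (one_div_combo_le hv hw hα hβ h) (P.commCoeff_pos s n).le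
  have h2 := one_div_combo_le hv' hw' hα hβ h
  have e : α * (pw v n - P.rate s n) + β * (pw w n - P.rate s n) =
      α * pw v n + β * pw w n - P.rate s n := by
    linear_combination -(P.rate s n : ℝ) * h
  rw [e] at h2
  linarith

theorem convex_globalSet : Convex ℝ P.globalSet := by
  intro x hx y hy α β hα hβ h s
  have key : ∀ {r u v : ℝ}, r < u → r < v → r < α * u + β * v := fun {r u v} hu hv =>
    (convex_Ioi r) hu hv hα hβ h
  refine ⟨fun n => ?_, fun n => ?_, fun n => ?_, ?_⟩
  · exact key ((hx s).1 n) ((hy s).1 n)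
  · exact key ((hx s).2.1 n) ((hy s).2.1 n)
  · refine (respTime_combo_le (bw_pos hx s n) (bw_pos hy s n) (load_pos hx s n)
      (load_pos hy s n) hα hβ h).trans ?_
    exact (convex_Iic (P.Tmax n)) ((hx s).2.2.1 n) ((hy s).2.2.1 n) hα hβ h
  · have e : ∑ n, P.threshold s n * bw ((α • x + β • y) s) n =
        α * ∑ n, P.threshold s n * bw (x s) n + β * ∑ n, P.threshold s n * bw (y s) n := by
      rw [Finset.mul_sum, Finset.mul_sum, ← Finset.sum_add_distrib]
      refine Finset.sum_congr rfl fun n _ => ?_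
      change P.threshold s n * (α * bw (x s) n + β * bw (y s) n) = _
      ring
    rw [e]
    exact (convex_Iic (P.β s)) (hx s).2.2.2 (hy s).2.2.2 hα hβ h

theorem convexOn_totalLatency : ConvexOn ℝ P.globalSet P.totalLatency := by
  refine ⟨convex_globalSet, fun x hx y hy α β hα hβ h => ?_⟩
  simp only [totalLatency, smul_eq_mul, Finset.mul_sum, ← Finset.sum_add_distrib]
  exact Finset.sum_le_sum fun s _ => Finset.sum_le_sum fun n _ =>
    respTime_combo_le (bw_pos hx s n) (bw_pos hy s n) (load_pos hx s n)
      (load_pos hy s n) hα hβ h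

variable (P) in
theorem exists_commCoeff_lower : ∃ c : ℝ, 0 < c ∧ c ≤ 1 ∧ ∀ s n, c ≤ P.commCoeff s n := by
  rcases isEmpty_or_nonempty (Fin S × Fin N) with h | h
  · exact ⟨1, one_pos, le_rfl, fun s n => (h.false (s, n)).elim⟩
  · obtain ⟨p, hp⟩ := Finite.exists_min fun p : Fin S × Fin N => P.commCoeff p.1 p.2
    exact ⟨min (P.commCoeff p.1 p.2) 1, lt_min (P.commCoeff_pos _ _) one_pos, min_le_right _ _,
      fun s n => (min_le_left _ _).trans (hp (s, n))⟩

/-- The total latency is strongly convex at midpoints on bounded parts of its domain. -/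
theorem exists_midpoint_gain (R : ℝ) : ∃ c : ℝ, 0 < c ∧ ∀ x ∈ P.globalSet, ∀ y ∈ P.globalSet,
    ‖x‖ ≤ R → ‖y‖ ≤ R →
    P.totalLatency ((1 / 2 : ℝ) • x + (1 / 2 : ℝ) • y) + c * ‖x - y‖ ^ 2 ≤
      1 / 2 * P.totalLatency x + 1 / 2 * P.totalLatency y := by
  obtain ⟨c, hc, hc1, hcle⟩ := P.exists_commCoeff_lower
  set B := |R| + 1 with hB
  have hB0 : 0 < B := by positivity
  refine ⟨c * (1 / (4 * B ^ 3)), by positivity, fun x hx y hy hxR hyR => ?_⟩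
  rw [norm_sq_eq_sum]
  simp only [totalLatency, Finset.mul_sum, ← Finset.sum_add_distrib]
  refine Finset.sum_le_sum fun s _ => Finset.sum_le_sum fun n _ => ?_
  have bound : ∀ v : GlobalVec S N, ‖v‖ ≤ R → bw (v s) n ≤ B ∧ pw (v s) n - P.rate s n ≤ B := by
    intro v hv
    have h1 := (abs_le.1 (abs_bw_le v s n)).2
    have h2 := (abs_le.1 (abs_pw_le v s n)).2
    have h3 := le_abs_self R
    have h4 := (P.rate s n).coe_nonneg
    constructor <;> linarith
  have h1 := one_div_midpoint_le (bw_pos hx s n) (bw_pos hy s n) (bound x hxR).1 (bound y hyR).1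
  have h2 := one_div_midpoint_le (load_pos hx s n) (load_pos hy s n) (bound x hxR).2
    (bound y hyR).2
  have h3 := mul_le_mul_of_nonneg_left h1 (P.commCoeff_pos s n).le
  have e : 1 / 2 * (pw (x s) n - P.rate s n) + 1 / 2 * (pw (y s) n - P.rate s n) =
      1 / 2 * pw (x s) n + 1 / 2 * pw (y s) n - P.rate s n := by ring
  rw [e] at h2
  have h4 : c * ((bw (x s) n - bw (y s) n) ^ 2 / (4 * B ^ 3)) ≤
      P.commCoeff s n * ((bw (x s) n - bw (y s) n) ^ 2 / (4 * B ^ 3)) := by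
    gcongr; exact hcle s n
  have h5 : c * ((pw (x s) n - pw (y s) n) ^ 2 / (4 * B ^ 3)) ≤
      1 * ((pw (x s) n - pw (y s) n) ^ 2 / (4 * B ^ 3)) := by
    gcongr
  have e2 : (pw (x s) n - P.rate s n - (pw (y s) n - P.rate s n)) =
    pw (x s) n - pw (y s) n := by ring
  rw [e2] at h2
  simp only [respTime_eq, PiLp.add_apply, PiLp.smul_apply, PiLp.sub_apply, bw_add, pw_add,
    bw_smul, pw_smul, bw_sub, pw_sub]
  have e3 : c * (1 / (4 * B ^ 3)) * ((bw (x s) n - bw (y s) n) ^ 2 +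
      (pw (x s) n - pw (y s) n) ^ 2) = c * ((bw (x s) n - bw (y s) n) ^ 2 / (4 * B ^ 3)) +
      c * ((pw (x s) n - pw (y s) n) ^ 2 / (4 * B ^ 3)) := by ring
  rw [e3]
  linarith

/-! ### Varying the processing powers -/

theorem shiftPower_mem {x : GlobalVec S N} (hx : x ∈ P.globalSet) {s₀ : Fin S} {n₀ : Fin N}
    {ε : ℝ} (h1 : 0 < pw (x s₀) n₀ + ε - P.rate s₀ n₀)
    (h2 : P.commCoeff s₀ n₀ * (1 / bw (x s₀) n₀) + 1 / (pw (x s₀) n₀ + ε - P.rate s₀ n₀) ≤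
      P.Tmax n₀) : shiftPower x s₀ n₀ ε ∈ P.globalSet := by
  intro s
  refine ⟨fun n => (hx s).1 n, fun n => ?_, fun n => ?_, (hx s).2.2.2⟩
  · rw [pw_shiftPower]
    split_ifs with h
    · obtain ⟨rfl, rfl⟩ := h; linarith
    · simpa using (hx s).2.1 n
  · rw [respTime_eq, pw_shiftPower, bw_shiftPower]
    split_ifs with h
    · obtain ⟨rfl, rfl⟩ := h; exact h2
    · rw [add_zero, ← respTime_eq]; exact (hx s).2.2.1 n

theorem shiftPower_mem_of_nonneg {x : GlobalVec S N} (hx : x ∈ P.globalSet) (s₀ : Fin S)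
    (n₀ : Fin N) {ε : ℝ} (hε : 0 ≤ ε) : shiftPower x s₀ n₀ ε ∈ P.globalSet := by
  have h0 := load_pos hx s₀ n₀
  refine shiftPower_mem hx (by linarith) (le_trans ?_ ((hx s₀).2.2.1 n₀))
  rw [respTime_eq]
  gcongr
  linarith

theorem totalLatency_shiftPower (x : GlobalVec S N) (s₀ : Fin S) (n₀ : Fin N) (ε : ℝ) :
    P.totalLatency (shiftPower x s₀ n₀ ε) = P.totalLatency x +
      (1 / (pw (x s₀) n₀ + ε - P.rate s₀ n₀) - 1 / (pw (x s₀) n₀ - P.rate s₀ n₀)) := by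
  rw [← sub_eq_iff_eq_add']
  simp only [totalLatency, ← Finset.sum_sub_distrib]
  rw [sum_sum_eq_single s₀ n₀]
  · simp [respTime_eq]
  · intro s n h
    simp [respTime_eq, h]

/-- At an optimum the computational resource is exhausted, since every latency strictly decreases
with the processing power. -/
theorem IsGlobalOptimum.inner_eq {xs : GlobalVec S N} (h : P.IsGlobalOptimum xs) (s₀ : Fin S)
    (n₀ : Fin N) : ⟪powerNormal S N, xs⟫ = P.γ := by
  obtain ⟨hK, hγ⟩ := isFeasible_iff.1 h.1
  refine hγ.antisymm (not_lt.1 fun hlt => ?_)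
  set ε := P.γ - ⟪powerNormal S N, xs⟫ with hε
  have hε0 : 0 < ε := sub_pos.2 hlt
  have hpw : pw (powerNormal S N s₀) n₀ = 1 := rfl
  have h1 := h.2 (shiftPower xs s₀ n₀ ε) (isFeasible_iff.2
    ⟨shiftPower_mem_of_nonneg hK s₀ n₀ hε0.le, by
      have := inner_shiftPower_sub (powerNormal S N) xs s₀ n₀ ε
      rw [inner_sub_right, hpw] at this
      linarith⟩)
  rw [totalLatency_shiftPower] at h1
  have h0 := load_pos hK s₀ n₀
  have h2 : 1 / (pw (xs s₀) n₀ + ε - P.rate s₀ n₀) < 1 / (pw (xs s₀) n₀ - P.rate s₀ n₀) :=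
    one_div_lt_one_div_of_lt h0 (by linarith)
  linarith

/-! ### Lagrange multipliers of the computational resource -/

theorem combo_eq {E : Type*} [AddCommGroup E] [Module ℝ E] (x y : E) (ε : ℝ) :
    (1 - ε) • x + ε • y = x + ε • (y - x) := by module

/-- If the latency constraint of one service is slack at the optimum, then its marginal queuing
delay is a multiplier: the excess of processing power of a competitor can be taken from that
service, to first order at this price. -/
theorem IsGlobalOptimum.multiplier_of_slack {xs : GlobalVec S N} (h : P.IsGlobalOptimum xs)
    {s₀ : Fin S} {n₀ : Fin N} (hslack : P.respTime s₀ (xs s₀) n₀ < P.Tmax n₀)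
    {y : GlobalVec S N} (hy : y ∈ P.globalSet) :
    P.totalLatency xs ≤ P.totalLatency y +
      (1 / (pw (xs s₀) n₀ - P.rate s₀ n₀)) ^ 2 * ⟪powerNormal S N, y - xs⟫ := by
  have hK := (isFeasible_iff.1 h.1).1
  have hγ := h.inner_eq s₀ n₀
  set δ := ⟪powerNormal S N, y - xs⟫ with hδ
  set c := P.commCoeff s₀ n₀
  set b : ℝ → ℝ := fun ε => bw (xs s₀) n₀ + ε * (bw (y s₀) n₀ - bw (xs s₀) n₀) with hb
  set m' : ℝ → ℝ := fun ε => pw (xs s₀) n₀ + ε * (pw (y s₀) n₀ - pw (xs s₀) n₀) - P.rate s₀ n₀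
    with hm'
  set m : ℝ → ℝ := fun ε => m' ε - ε * δ with hm
  have hb0 : b 0 = bw (xs s₀) n₀ := by simp [hb]
  have hm'0 : m' 0 = pw (xs s₀) n₀ - P.rate s₀ n₀ := by simp [hm']
  have hm0 : m 0 = pw (xs s₀) n₀ - P.rate s₀ n₀ := by simp [hm, hm']
  have hbp := bw_pos hK s₀ n₀
  have hmp := load_pos hK s₀ n₀
  have cb : ContinuousAt b 0 := by fun_prop
  have cm' : ContinuousAt m' 0 := by fun_prop
  have cm : ContinuousAt m 0 := by fun_prop
  have cl : ContinuousAt (fun ε => c * (1 / b ε) + 1 / m ε) 0 :=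
    (continuousAt_const.mul (continuousAt_const.div cb (by rw [hb0]; exact hbp.ne'))).add
      (continuousAt_const.div cm (by rw [hm0]; exact hmp.ne'))
  have ev1 : ∀ᶠ ε in 𝓝 (0 : ℝ), 0 < m ε := cm.eventually (lt_mem_nhds (by rw [hm0]; exact hmp))
  have ev2 : ∀ᶠ ε in 𝓝 (0 : ℝ), c * (1 / b ε) + 1 / m ε < P.Tmax n₀ :=
    cl.eventually (gt_mem_nhds (by simp only [hb0, hm0]; rw [← respTime_eq]; exact hslack))
  have ev3 : ∀ᶠ ε in 𝓝[>] (0 : ℝ), ε ∈ Set.Ioc (0 : ℝ) 1 := Ioc_mem_nhdsGT one_pos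
  have key : ∀ᶠ ε in 𝓝[>] (0 : ℝ),
      0 ≤ P.totalLatency y - P.totalLatency xs + δ / (m ε * m' ε) := by
    filter_upwards [ev1.filter_mono nhdsWithin_le_nhds, ev2.filter_mono nhdsWithin_le_nhds, ev3]
      with ε e1 e2 ⟨e3, e4⟩
    have hx : xs + ε • (y - xs) ∈ P.globalSet := by
      rw [← combo_eq]
      exact convex_globalSet hK hy (by linarith) e3.le (by ring)
    have hcv := convexOn_totalLatency.2 hK hy (by linarith : 0 ≤ 1 - ε) e3.le (by ring)
    rw [combo_eq, smul_eq_mul, smul_eq_mul] at hcv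
    set xε := xs + ε • (y - xs) with hxε
    have hpx : pw (xε s₀) n₀ = m' ε + P.rate s₀ n₀ := by
      simp only [hm', hxε, PiLp.add_apply, PiLp.smul_apply, PiLp.sub_apply, pw_add, pw_smul,
        pw_sub]
      ring
    have hbx : bw (xε s₀) n₀ = b ε := rfl
    have hmx : pw (xε s₀) n₀ + -(ε * δ) - P.rate s₀ n₀ = m ε := by rw [hpx, hm]; ring
    have hmx' : pw (xε s₀) n₀ - P.rate s₀ n₀ = m' ε := by rw [hpx]; ring
    have hm'p : 0 < m' ε := by rw [← hmx']; exact load_pos hx s₀ n₀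
    have hmem : shiftPower xε s₀ n₀ (-(ε * δ)) ∈ P.globalSet :=
      shiftPower_mem hx (by rw [hmx]; exact e1) (by rw [hmx, hbx]; exact e2.le)
    have hpw : pw (powerNormal S N s₀) n₀ = 1 := rfl
    have hin := inner_shiftPower_sub (powerNormal S N) xε s₀ n₀ (-(ε * δ))
    rw [inner_sub_right, hpw, hxε, inner_add_right, inner_smul_right, ← hδ, hγ, ← hxε] at hin
    have hopt := h.2 _ (isFeasible_iff.2 ⟨hmem, by linarith⟩)
    rw [totalLatency_shiftPower, hmx, hmx'] at hopt
    have hdiff : 1 / m ε - 1 / m' ε = ε * (δ / (m ε * m' ε)) := by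
      have : m' ε = m ε + ε * δ := by simp only [hm]; ring
      field_simp
      linarith
    have : 0 ≤ ε * (P.totalLatency y - P.totalLatency xs + δ / (m ε * m' ε)) := by
      rw [hdiff] at hopt; linarith
    exact nonneg_of_mul_nonneg_right this e3
  have hlim : Tendsto (fun ε => P.totalLatency y - P.totalLatency xs + δ / (m ε * m' ε))
      (𝓝[>] 0) (𝓝 (P.totalLatency y - P.totalLatency xs + δ / (m 0 * m' 0))) := by
    refine ContinuousAt.tendsto (x := (0 : ℝ)) (continuousAt_const.add (continuousAt_const.div
      (cm.mul cm') ?_)) |>.mono_left nhdsWithin_le_nhds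
    change m 0 * m' 0 ≠ 0
    rw [hm0, hm'0]; exact (mul_pos hmp hmp).ne'
  have hfin := ge_of_tendsto hlim key
  rw [hm0, hm'0] at hfin
  have e : δ / ((pw (xs s₀) n₀ - P.rate s₀ n₀) * (pw (xs s₀) n₀ - P.rate s₀ n₀)) =
      (1 / (pw (xs s₀) n₀ - P.rate s₀ n₀)) ^ 2 * δ := by
    rw [← sq, one_div, inv_pow, div_eq_inv_mul]
  rw [e] at hfin
  linarith

/-- If all latency constraints are active at the optimum, lower the processing powers of a
competitor until all its latencies are maximal too. It then has the total latency of the optimum,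
hence uses at least as much processing power, and the tangent lines at the lowered powers bound
what the competitor gained by its excess. -/
theorem IsGlobalOptimum.le_add_of_tight {xs : GlobalVec S N} (h : P.IsGlobalOptimum xs)
    (s₀ : Fin S) (n₀ : Fin N) (htight : ∀ s n, P.respTime s (xs s) n = P.Tmax n)
    {x : GlobalVec S N} (hx : x ∈ P.globalSet) {M : ℝ}
    (hM : ∀ s n, (P.Tmax n - P.commCoeff s n * (1 / bw (x s) n)) ^ 2 ≤ M) :
    P.totalLatency xs ≤ P.totalLatency x + M * ⟪powerNormal S N, x - xs⟫ := by
  have hγ := h.inner_eq s₀ n₀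
  set κ : Fin S → Fin N → ℝ := fun s n => P.Tmax n - P.commCoeff s n * (1 / bw (x s) n) with hκ
  have hql : ∀ s n, 1 / (pw (x s) n - P.rate s n) ≤ κ s n := by
    intro s n
    have := (hx s).2.2.1 n
    rw [respTime_eq] at this
    simp only [hκ]; linarith
  have hκ0 : ∀ s n, 0 < κ s n := fun s n =>
    (one_div_pos.2 (load_pos hx s n)).trans_le (hql s n)
  have hle : ∀ s n, P.rate s n + 1 / κ s n ≤ pw (x s) n := by
    intro s n
    have := one_div_le_one_div_of_le (one_div_pos.2 (load_pos hx s n)) (hql s n)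
    rw [one_div_one_div] at this
    linarith
  set x' := withPower x fun s n => P.rate s n + 1 / κ s n with hx'
  have hresp : ∀ s n, P.respTime s (x' s) n = P.Tmax n := by
    intro s n
    rw [respTime_eq, hx', pw_withPower, bw_withPower, add_sub_cancel_left, one_div_one_div]
    simp only [hκ]; ring
  have hx'K : x' ∈ P.globalSet := fun s =>
    ⟨(hx s).1, fun n => by
      rw [hx', pw_withPower]
      linarith [one_div_pos.2 (hκ0 s n)], fun n => (hresp s n).le, (hx s).2.2.2⟩
  have hF : P.totalLatency x' = P.totalLatency xs := by
    simp only [totalLatency, hresp, htight]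
  -- otherwise `x'` would be an optimum that does not exhaust the resource
  have hsum : P.γ ≤ ⟪powerNormal S N, x'⟫ := by
    by_contra! hlt
    have hopt : P.IsGlobalOptimum x' :=
      ⟨isFeasible_iff.2 ⟨hx'K, hlt.le⟩, fun y hy => hF ▸ h.2 y hy⟩
    exact hlt.ne (hopt.inner_eq s₀ n₀)
  have hdiff : P.totalLatency x' - P.totalLatency x ≤
      M * (⟪powerNormal S N, x⟫ - ⟪powerNormal S N, x'⟫) := by
    rw [inner_powerNormal, inner_powerNormal]
    simp only [totalLatency, ← Finset.sum_sub_distrib, Finset.mul_sum]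
    refine Finset.sum_le_sum fun s _ => Finset.sum_le_sum fun n _ => ?_
    rw [respTime_eq, respTime_eq, hx', pw_withPower, bw_withPower]
    have ht := one_div_ge_tangent (one_div_pos.2 (hκ0 s n)) (load_pos hx s n)
    have h1 : 1 / (1 / κ s n) - (pw (x s) n - P.rate s n - 1 / κ s n) / (1 / κ s n) ^ 2 =
        κ s n - κ s n ^ 2 * (pw (x s) n - (P.rate s n + 1 / κ s n)) := by
      have := (hκ0 s n).ne'
      field_simp
      ring
    rw [h1] at ht
    have h2 : κ s n ^ 2 * (pw (x s) n - (P.rate s n + 1 / κ s n)) ≤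
        M * (pw (x s) n - (P.rate s n + 1 / κ s n)) :=
      mul_le_mul_of_nonneg_right (hM s n) (sub_nonneg.2 (hle s n))
    rw [add_sub_cancel_left, one_div_one_div]
    linarith
  have hM0 : 0 ≤ M := (sq_nonneg _).trans (hM s₀ n₀)
  rw [inner_sub_right, hγ]
  have := mul_le_mul_of_nonneg_left hsum hM0
  linarith

/-- If all latency constraints are active at the optimum, then every number above all marginal
queuing delays is a multiplier. -/
theorem IsGlobalOptimum.multiplier_of_tight {xs : GlobalVec S N} (h : P.IsGlobalOptimum xs)
    (s₀ : Fin S) (n₀ : Fin N) (htight : ∀ s n, P.respTime s (xs s) n = P.Tmax n) {M : ℝ}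
    (hM : ∀ s n, (1 / (pw (xs s) n - P.rate s n)) ^ 2 ≤ M)
    {y : GlobalVec S N} (hy : y ∈ P.globalSet) :
    P.totalLatency xs ≤ P.totalLatency y + M * ⟪powerNormal S N, y - xs⟫ := by
  have hK := (isFeasible_iff.1 h.1).1
  set δ := ⟪powerNormal S N, y - xs⟫ with hδ
  suffices hη : 0 ≤ P.totalLatency y - P.totalLatency xs + M * δ by linarith
  refine le_of_forall_small_mul_le (B := δ) fun η hη _ => ?_
  have ev : ∀ᶠ ε in 𝓝 (0 : ℝ), ∀ s n, (P.Tmax n - P.commCoeff s n *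
      (1 / (bw (xs s) n + ε * (bw (y s) n - bw (xs s) n)))) ^ 2 < M + η := by
    refine eventually_all.2 fun s => eventually_all.2 fun n => ?_
    have hc : ContinuousAt (fun ε : ℝ => (P.Tmax n - P.commCoeff s n *
        (1 / (bw (xs s) n + ε * (bw (y s) n - bw (xs s) n)))) ^ 2) 0 :=
      (continuousAt_const.sub (continuousAt_const.mul (continuousAt_const.div (by fun_prop)
        (by simpa using (bw_pos hK s n).ne')))).pow 2
    refine hc.eventually (gt_mem_nhds ?_)
    have h1 := htight s n
    rw [respTime_eq] at h1
    have h2 : P.Tmax n - P.commCoeff s n * (1 / (bw (xs s) n + 0 * (bw (y s) n - bw (xs s) n)))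
        = 1 / (pw (xs s) n - P.rate s n) := by rw [zero_mul, add_zero]; linarith
    beta_reduce
    rw [h2]
    linarith [hM s n]
  have ev3 : ∀ᶠ ε in 𝓝[>] (0 : ℝ), ε ∈ Set.Ioc (0 : ℝ) 1 := Ioc_mem_nhdsGT one_pos
  obtain ⟨ε, e1, e3, e4⟩ := ((ev.filter_mono nhdsWithin_le_nhds).and ev3).exists
  have hx : xs + ε • (y - xs) ∈ P.globalSet := by
    rw [← combo_eq]
    exact convex_globalSet hK hy (by linarith) e3.le (by ring)
  have hcv := convexOn_totalLatency.2 hK hy (by linarith : 0 ≤ 1 - ε) e3.le (by ring)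
  rw [combo_eq, smul_eq_mul, smul_eq_mul] at hcv
  have h1 := h.le_add_of_tight s₀ n₀ htight hx (M := M + η) fun s n => (e1 s n).le
  rw [add_sub_cancel_left, inner_smul_right, ← hδ] at h1
  have : 0 ≤ ε * (P.totalLatency y - P.totalLatency xs + M * δ + η * δ) := by linarith
  exact nonneg_of_mul_nonneg_right this e3

/-! ### The dual error bound -/

/-- Raising one processing power is always feasible, which bounds its marginal queuing delay by
the price. -/
theorem sq_le_of_variational {ρ σ : ℝ} {y e : GlobalVec S N} (hy : y ∈ P.globalSet)
    (hvi : ∀ v ∈ P.globalSet, P.totalLatency y ≤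
      P.totalLatency v + ρ * ⟪σ • powerNormal S N + e, v - y⟫) (s₀ : Fin S) (n₀ : Fin N) :
    (1 / (pw (y s₀) n₀ - P.rate s₀ n₀)) ^ 2 ≤ ρ * (σ + pw (e s₀) n₀) := by
  have hm := load_pos hy s₀ n₀
  refine sq_le_of_eventually_one_div_le hm ?_
  filter_upwards [self_mem_nhdsWithin] with ε (hε : 0 < ε)
  have h1 := hvi _ (shiftPower_mem_of_nonneg hy s₀ n₀ hε.le)
  rw [inner_shiftPower_sub, totalLatency_shiftPower,
    show pw (y s₀) n₀ + ε - P.rate s₀ n₀ = pw (y s₀) n₀ - P.rate s₀ n₀ + ε by ring] at h1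
  set m := pw (y s₀) n₀ - P.rate s₀ n₀
  have hp : pw ((σ • powerNormal S N + e) s₀) n₀ = σ + pw (e s₀) n₀ := by
    change σ * 1 + pw (e s₀) n₀ = _
    ring
  rw [hp] at h1
  have hd : 1 / (m + ε) - 1 / m = -(ε * (1 / (m * (m + ε)))) := by
    field_simp; ring
  have : 0 ≤ ε * (ρ * (σ + pw (e s₀) n₀) - 1 / (m * (m + ε))) := by
    rw [hd] at h1; linarith
  linarith [nonneg_of_mul_nonneg_right this hε]

/-- Lowering a processing power is feasible if the latency is slack, which bounds its marginal
queuing delay from below. -/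
theorem le_sq_of_variational {ρ σ : ℝ} {y e : GlobalVec S N} (hy : y ∈ P.globalSet)
    (hvi : ∀ v ∈ P.globalSet, P.totalLatency y ≤
      P.totalLatency v + ρ * ⟪σ • powerNormal S N + e, v - y⟫) {s₀ : Fin S} {n₀ : Fin N}
    (hslack : P.respTime s₀ (y s₀) n₀ < P.Tmax n₀) :
    ρ * (σ + pw (e s₀) n₀) ≤ (1 / (pw (y s₀) n₀ - P.rate s₀ n₀)) ^ 2 := by
  have hm := load_pos hy s₀ n₀
  refine le_sq_of_eventually_le_one_div hm ?_
  rw [respTime_eq] at hslack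
  set m := pw (y s₀) n₀ - P.rate s₀ n₀ with hmd
  have hc : ContinuousAt (fun ε : ℝ => P.commCoeff s₀ n₀ * (1 / bw (y s₀) n₀) + 1 / (m - ε)) 0 :=
    continuousAt_const.add (continuousAt_const.div (by fun_prop) (by simpa using hm.ne'))
  have ev := hc.eventually (gt_mem_nhds (by simpa using hslack))
  filter_upwards [self_mem_nhdsWithin, ev.filter_mono nhdsWithin_le_nhds,
    (gt_mem_nhds hm).filter_mono nhdsWithin_le_nhds] with ε (hε : 0 < ε) hl hεm
  have hmε : pw (y s₀) n₀ + -ε - P.rate s₀ n₀ = m - ε := by rw [hmd]; ring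
  have h1 := hvi _ (shiftPower_mem hy (s₀ := s₀) (n₀ := n₀) (ε := -ε)
    (by rw [hmε]; linarith) (by rw [hmε]; exact hl.le))
  rw [inner_shiftPower_sub, totalLatency_shiftPower, hmε, ← hmd] at h1
  have hp : pw ((σ • powerNormal S N + e) s₀) n₀ = σ + pw (e s₀) n₀ := by
    change σ * 1 + pw (e s₀) n₀ = _
    ring
  rw [hp] at h1
  have hmε0 : 0 < m - ε := by linarith
  have hd : 1 / (m - ε) - 1 / m = ε * (1 / (m * (m - ε))) := by
    field_simp; ring
  have : 0 ≤ ε * (1 / (m * (m - ε)) - ρ * (σ + pw (e s₀) n₀)) := by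
    rw [hd] at h1; linarith
  linarith [nonneg_of_mul_nonneg_right this hε]

/-- There is a map onto the known multipliers, optimal among them, such that near the optimum the
dual error is at most proportional to the primal error and the perturbation of the stationarity
condition. If some latency is slack at the optimum the map is constant. If all are tight, the
multipliers are unbounded and the map truncates the price from below. -/
theorem IsGlobalOptimum.exists_dual_error_bound {xs : GlobalVec S N} (h : P.IsGlobalOptimum xs)
    (s₀ : Fin S) (n₀ : Fin N) {ρ : ℝ} (hρ : 0 < ρ) :
    ∃ π : ℝ → ℝ,
      (∀ σ, IsScaledMultiplier P.globalSet P.totalLatency (powerNormal S N) ρ xs (π σ)) ∧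
      (∀ σ σ', |σ - π σ| ≤ |σ - π σ'|) ∧
      ∃ r κ : ℝ, 0 < r ∧ 0 ≤ κ ∧ ∀ y ∈ P.globalSet, ‖y - xs‖ ≤ r →
        ∀ (σ : ℝ) (e : GlobalVec S N), 0 ≤ σ →
        (∀ v ∈ P.globalSet, P.totalLatency y ≤
          P.totalLatency v + ρ * ⟪σ • powerNormal S N + e, v - y⟫) →
        |σ - π σ| ≤ κ * (‖y - xs‖ + ‖e‖) := by
  have hK := (isFeasible_iff.1 h.1).1
  set q : Fin S → Fin N → ℝ := fun s n => (1 / (pw (xs s) n - P.rate s n)) ^ 2 with hq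
  -- the marginal queuing delay depends on the power in a locally Lipschitz way
  have hlip : ∀ s n, ∀ y : GlobalVec S N, ‖y - xs‖ ≤ (pw (xs s) n - P.rate s n) / 2 →
      |(1 / (pw (y s) n - P.rate s n)) ^ 2 - q s n| ≤
        10 / (pw (xs s) n - P.rate s n) ^ 3 * ‖y - xs‖ := by
    intro s n y hy
    have hd : |pw (y s) n - P.rate s n - (pw (xs s) n - P.rate s n)| ≤ ‖y - xs‖ := by
      rw [sub_sub_sub_cancel_right]
      exact abs_pw_le (y - xs) s n
    have h0 := load_pos hK s n
    refine (abs_inv_sq_sub_le h0 (hd.trans hy)).trans ?_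
    gcongr
  have hq0 : ∀ s n, 0 ≤ q s n := fun s n => sq_nonneg _
  by_cases hslack : ∃ s n, P.respTime s (xs s) n < P.Tmax n
  · obtain ⟨s, n, hsn⟩ := hslack
    have hm := load_pos hK s n
    obtain ⟨r, hr, hball⟩ : ∃ r : ℝ, 0 < r ∧ ∀ y : GlobalVec S N, ‖y - xs‖ ≤ r →
        P.respTime s (y s) n < P.Tmax n := by
      have cb : Continuous fun y : GlobalVec S N => bw (y s) n := by unfold bw; fun_prop
      have cp : Continuous fun y : GlobalVec S N => pw (y s) n := by unfold pw; fun_prop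
      have hc : ContinuousAt (fun y : GlobalVec S N => P.respTime s (y s) n) xs := by
        simp only [respTime_eq]
        exact (continuousAt_const.mul (continuousAt_const.div cb.continuousAt
          (bw_pos hK s n).ne')).add (continuousAt_const.div
          (cp.continuousAt.sub continuousAt_const) hm.ne')
      obtain ⟨r, hr, hb⟩ := Metric.eventually_nhds_iff.1 (hc.eventually (gt_mem_nhds hsn))
      exact ⟨r / 2, by positivity, fun y hy => hb (by rw [dist_eq_norm]; linarith)⟩
    set Λ := 10 / (pw (xs s) n - P.rate s n) ^ 3
    have hΛ : 0 ≤ Λ := by positivity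
    refine ⟨fun _ => q s n / ρ, fun σ => ⟨by have := hq0 s n; positivity, fun y hy => ?_⟩,
      fun σ σ' => le_rfl, min r ((pw (xs s) n - P.rate s n) / 2), 1 + Λ / ρ,
      lt_min hr (by positivity), by positivity, fun y hy hyr σ e _ hvi => ?_⟩
    · rw [mul_div_cancel₀ _ hρ.ne']
      exact h.multiplier_of_slack hsn hy
    · have h1 := sq_le_of_variational hy hvi s n
      have h2 := le_sq_of_variational hy hvi (hball y (hyr.trans (min_le_left _ _)))
      obtain ⟨h3, h4⟩ := abs_le.1 (hlip s n y (hyr.trans (min_le_right _ _)))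
      obtain ⟨h5, h6⟩ := abs_le.1 (abs_pw_le e s n)
      have h7 : |ρ * σ - q s n| ≤ ρ * ‖e‖ + Λ * ‖y - xs‖ := by
        have := mul_le_mul_of_nonneg_left h5 hρ.le
        have := mul_le_mul_of_nonneg_left h6 hρ.le
        rw [abs_le]
        constructor <;> linarith
      have h8 : σ - q s n / ρ = (ρ * σ - q s n) / ρ := by field_simp
      rw [h8, abs_div, abs_of_pos hρ, div_le_iff₀ hρ]
      refine h7.trans ?_
      have h9 : (1 + Λ / ρ) * (‖y - xs‖ + ‖e‖) * ρ =
          ρ * ‖y - xs‖ + ρ * ‖e‖ + Λ * ‖y - xs‖ + Λ * ‖e‖ := by field_simp; ring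
      have : 0 ≤ ρ * ‖y - xs‖ := by positivity
      have : 0 ≤ Λ * ‖e‖ := by positivity
      linarith
  · push Not at hslack
    have htight : ∀ s n, P.respTime s (xs s) n = P.Tmax n := fun s n =>
      ((hK s).2.2.1 n).antisymm (hslack s n)
    have : Nonempty (Fin S × Fin N) := ⟨(s₀, n₀)⟩
    obtain ⟨⟨s, n⟩, hmax⟩ := Finite.exists_max fun p : Fin S × Fin N => q p.1 p.2
    have hm := load_pos hK s n
    have hqρ : 0 ≤ q s n / ρ := div_nonneg (hq0 s n) hρ.le
    set Λ := 10 / (pw (xs s) n - P.rate s n) ^ 3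
    have hΛ : 0 ≤ Λ := by positivity
    refine ⟨fun σ => max σ (q s n / ρ), fun σ => ⟨le_max_of_le_right hqρ, fun y hy => ?_⟩,
      fun σ σ' => ?_, (pw (xs s) n - P.rate s n) / 2, 1 + Λ / ρ, by positivity, by positivity,
      fun y hy hyr σ e _ hvi => ?_⟩
    · refine h.multiplier_of_tight s₀ n₀ htight (fun s' n' => ?_) hy
      calc q s' n' ≤ q s n := hmax (s', n')
        _ = ρ * (q s n / ρ) := by field_simp
        _ ≤ ρ * max σ (q s n / ρ) := by gcongr; exact le_max_right _ _
    · beta_reduce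
      rcases le_total (q s n / ρ) σ with h1 | h1
      · simp [max_eq_left h1]
      · rw [max_eq_right h1, abs_sub_comm, abs_sub_comm σ, abs_of_nonneg (sub_nonneg.2 h1)]
        exact (sub_le_sub_right (le_max_right σ' _) σ).trans (le_abs_self _)
    · have h1 := sq_le_of_variational hy hvi s n
      have h3 := (abs_le.1 (hlip s n y hyr)).1
      have h6 := mul_le_mul_of_nonneg_left (abs_le.1 (abs_pw_le e s n)).2 hρ.le
      beta_reduce
      rcases le_total (q s n / ρ) σ with h2 | h2
      · rw [max_eq_left h2, sub_self, abs_zero]; positivity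
      · rw [max_eq_right h2, abs_sub_comm, abs_of_nonneg (sub_nonneg.2 h2)]
        have h8 : q s n / ρ - σ = (q s n - ρ * σ) / ρ := by field_simp
        rw [h8, div_le_iff₀ hρ]
        have h9 : (1 + Λ / ρ) * (‖y - xs‖ + ‖e‖) * ρ =
            ρ * ‖y - xs‖ + ρ * ‖e‖ + Λ * ‖y - xs‖ + Λ * ‖e‖ := by field_simp; ring
        have : 0 ≤ ρ * ‖y - xs‖ := by positivity
        have : 0 ≤ Λ * ‖e‖ := by positivity
        linarith

/-! ### Linear convergence of the algorithm -/

/-- The Lagrangian grows quadratically on bounded sets, uniformly in the multiplier. -/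
theorem exists_lagrangian_growth {xs : GlobalVec S N} (hK : xs ∈ P.globalSet) {ρ R : ℝ}
    (hR : 0 ≤ R) : ∃ c : ℝ, 0 < c ∧ ∀ σ : ℝ,
      IsScaledMultiplier P.globalSet P.totalLatency (powerNormal S N) ρ xs σ →
      ∀ y ∈ P.globalSet, ‖y - xs‖ ≤ R →
      P.totalLatency xs + c * ‖y - xs‖ ^ 2 ≤
        P.totalLatency y + ρ * σ * ⟪powerNormal S N, y - xs⟫ := by
  obtain ⟨c, hc, hgain⟩ := exists_midpoint_gain (P := P) (R + ‖xs‖)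
  refine ⟨2 * c, by positivity, fun σ hσ y hy hyR => ?_⟩
  have h1 := hgain y hy xs hK
    (by have := norm_add_le (y - xs) xs; rw [sub_add_cancel] at this; linarith) (by linarith)
  have h2 := hσ.2 _ (convex_globalSet hy hK (by norm_num : (0 : ℝ) ≤ 1 / 2)
    (by norm_num : (0 : ℝ) ≤ 1 / 2) (by norm_num))
  have e : (1 / 2 : ℝ) • y + (1 / 2 : ℝ) • xs - xs = (1 / 2 : ℝ) • (y - xs) := by module
  rw [e, inner_smul_right] at h2
  linarith

/-- From its first iterate on, a run of the algorithm is a splitting between the product of the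
local sets and the half-space. -/
theorem IsRun.exists_splitting {ρ : ℝ} {x z L : ℕ → GlobalVec S N} (hrun : P.IsRun ρ x z L)
    {xs : GlobalVec S N} (h : P.IsGlobalOptimum xs) (s₀ : Fin S) (n₀ : Fin N) :
    ∃ τ : ℕ → ℝ, HalfSpaceSplitting P.globalSet P.totalLatency (powerNormal S N) ρ xs
      (fun k => x (k + 1)) (fun k => z (k + 1)) τ := by
  have hγ := h.inner_eq s₀ n₀
  have ha : powerNormal S N ≠ 0 := fun h0 => by
    have h1 : pw (powerNormal S N s₀) n₀ = 1 := rfl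
    rw [h0] at h1
    exact zero_ne_one h1
  have hhalf : P.halfSpace = {y | ⟪powerNormal S N, y⟫ ≤ P.γ} := by
    simp only [halfSpace, inner_powerNormal]
  have hproj : ∀ k, ∃ τ : ℝ, 0 ≤ τ ∧ L (k + 1) = τ • powerNormal S N ∧
      τ * (⟪powerNormal S N, z (k + 1)⟫ - P.γ) = 0 := by
    intro k
    have h1 := hrun.z_mem k
    have h2 := hrun.z_min k
    rw [hhalf] at h1 h2
    obtain ⟨τ, h3, h4, h5⟩ := exists_normal_of_isMinOn_dist ha h1 h2
    exact ⟨τ, h3, by rw [← h4, hrun.dual_update k, add_comm (L k)], h5⟩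
  choose τ hτ0 hτL hτs using hproj
  refine ⟨τ, ⟨fun k s => hrun.x_mem (k + 1) s, fun k y hy => ?_, fun k => ?_, hτ0, fun k => ?_,
    fun k => ?_⟩⟩
  · -- the proximal steps of the base stations add up to a global proximal step
    have hmin : IsMinOn (fun v => P.totalLatency v + ρ / 2 * ‖v - (z (k + 1) - L (k + 1))‖ ^ 2)
        P.globalSet (x (k + 1 + 1)) := by
      have hsum : ∀ v : GlobalVec S N,
          P.totalLatency v + ρ / 2 * ‖v - (z (k + 1) - L (k + 1))‖ ^ 2 =
          ∑ s, P.proxObjective ρ s (z (k + 1) s) (L (k + 1) s) (v s) := by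
        intro v
        simp only [proxObjective, localLatency, totalLatency, Finset.sum_add_distrib,
          ← Finset.mul_sum]
        rw [PiLp.norm_sq_eq_of_L2]
        simp only [PiLp.sub_apply, PiLp.add_apply, sub_sub_eq_add_sub, sub_add_eq_add_sub]
      intro v hv
      simp only [Set.mem_ofPred_eq, hsum]
      exact Finset.sum_le_sum fun s _ => hrun.x_min (k + 1) s (hv s)
    have h1 := prox_variational convexOn_totalLatency
      (fun s => hrun.x_mem (k + 1) s) hmin hy
    rwa [hτL k, ← sub_add] at h1
  · have := hrun.z_mem k
    rw [hhalf] at this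
    rw [inner_sub_right, hγ]
    exact sub_nonpos.2 this
  · rw [inner_sub_right, hγ]
    exact hτs k
  · rw [sub_smul, ← hτL, ← hτL, hrun.dual_update (k + 1)]
    abel

/-- Every run converges to the optimum at a geometric rate. -/
theorem IsRun.geometric_rate {ρ : ℝ} (hρ : 0 < ρ) {x z L : ℕ → GlobalVec S N}
    (hrun : P.IsRun ρ x z L) {xs : GlobalVec S N} (h : P.IsGlobalOptimum xs) (s₀ : Fin S)
    (n₀ : Fin N) : ∃ C q : ℝ, 0 ≤ q ∧ q < 1 ∧ ∀ᶠ k in atTop,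
      ‖x (k + 2) - xs‖ ≤ C * q ^ k ∧ ‖z (k + 2) - xs‖ ≤ C * q ^ k ∧
      |P.totalLatency (x (k + 2)) - P.totalLatency xs| ≤ C * q ^ k := by
  have hK := (isFeasible_iff.1 h.1).1
  obtain ⟨τ, H⟩ := hrun.exists_splitting h s₀ n₀
  obtain ⟨π, hπ, hproj, herr⟩ := h.exists_dual_error_bound s₀ n₀ hρ
  obtain ⟨C, q, hq0, hq1, hrate⟩ := H.linear_rate hρ hK hπ hproj (fun R hR => by
    obtain ⟨c, hc, hgr⟩ := exists_lagrangian_growth hK (ρ := ρ) hR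
    exact ⟨c, hc, fun σ => hgr (π σ) (hπ σ)⟩) herr
  obtain ⟨B, hB0, hB⟩ := H.objective_error hρ hK (hπ 0)
  refine ⟨(B + 1) * C, q, hq0, hq1, hrate.mono fun k hk => ?_⟩
  have hC : 0 ≤ C * q ^ k := (norm_nonneg _).trans hk.1
  have hBC : C * q ^ k ≤ (B + 1) * C * q ^ k := by nlinarith [mul_nonneg hB0 hC]
  refine ⟨hk.1.trans hBC, hk.2.trans hBC, (hB k).trans ?_⟩
  calc B * ‖x (k + 1 + 1) - xs‖ ≤ B * (C * q ^ k) := mul_le_mul_of_nonneg_left hk.1 hB0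
    _ ≤ (B + 1) * C * q ^ k := by linarith

end Network

end Network

theorem tendsto_of_norm_sub_le_div {E : Type*} [SeminormedAddCommGroup E] {u : ℕ → E} {l : E}
    {C : ℝ} (h : ∀ t : ℕ, 1 ≤ t → ‖u t - l‖ ≤ C / t) : Tendsto u atTop (𝓝 l) :=
  tendsto_iff_norm_sub_tendsto_zero.2 (squeeze_zero' (Eventually.of_forall fun _ => norm_nonneg _)
    ((eventually_ge_atTop 1).mono h) (tendsto_const_div_atTop_nhds_zero_nat C))

end NetSlicing

theorem theorem2 {S N : ℕ} (P : NetSlicing.Network S N) (ρ : ℝ) (hρ : 0 < ρ)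
    (xopt : NetSlicing.GlobalVec S N) (hopt : P.IsGlobalOptimum xopt)
    (x z L : ℕ → NetSlicing.GlobalVec S N) (hrun : P.IsRun ρ x z L) :
    Tendsto x atTop (𝓝 xopt) ∧
    Tendsto z atTop (𝓝 xopt) ∧
    Tendsto (fun t => P.totalLatency (x t)) atTop (𝓝 (P.totalLatency xopt)) ∧
    ∃ C : ℝ, ∀ t : ℕ, 1 ≤ t →
      ‖x t - xopt‖ ≤ C / t ∧
      ‖z t - xopt‖ ≤ C / t ∧
      |P.totalLatency (x t) - P.totalLatency xopt| ≤ C / t := by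
  suffices hC : ∃ C : ℝ, ∀ t : ℕ, 1 ≤ t → ‖x t - xopt‖ ≤ C / t ∧ ‖z t - xopt‖ ≤ C / t ∧
      |P.totalLatency (x t) - P.totalLatency xopt| ≤ C / t by
    obtain ⟨C, hC⟩ := hC
    exact ⟨NetSlicing.tendsto_of_norm_sub_le_div fun t ht => (hC t ht).1,
      NetSlicing.tendsto_of_norm_sub_le_div fun t ht => (hC t ht).2.1,
      NetSlicing.tendsto_of_norm_sub_le_div fun t ht => (hC t ht).2.2, C, hC⟩
  rcases isEmpty_or_nonempty (Fin S × Fin N) with hE | ⟨⟨s₀, n₀⟩⟩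
  · -- without base stations or services there is only one vector
    have hsub : ∀ v : NetSlicing.GlobalVec S N, v = xopt := fun v => by
      ext s i
      rcases i with n | n <;> exact (hE.false (s, n)).elim
    exact ⟨0, fun t _ => by simp [hsub (x t), hsub (z t)]⟩
  · obtain ⟨C, q, hq0, hq1, hrate⟩ := hrun.geometric_rate hρ hopt s₀ n₀
    obtain ⟨B, hB⟩ := NetSlicing.exists_le_div_of_eventually_geometric
      (u := fun t => ‖x t - xopt‖ + ‖z t - xopt‖ +
        |P.totalLatency (x t) - P.totalLatency xopt|) (C := 3 * C) 2
      (fun t => by positivity) hq0 hq1 (hrate.mono fun k hk => by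
        obtain ⟨h1, h2, h3⟩ := hk
        linarith)
    refine ⟨B, fun t ht => ?_⟩
    have h := hB t ht
    have h1 := norm_nonneg (x t - xopt)
    have h2 := norm_nonneg (z t - xopt)
    have h3 := abs_nonneg (P.totalLatency (x t) - P.totalLatency xopt)
    refine ⟨by linarith, by linarith, by linarith⟩
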